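/- Let $\mathfrak S_n$ be the set of permutations $\pi=\pi_1\pi_2\cdots\pi_n$ of $[n]=\{1,\dots,n\}$. For a word $w=w_1\cdots w_m$ of distinct integers let $\mathsf{inv}(w)$ be the number of pairs $i<j$ with $w_i>w_j$. For $r\ge 1$ and $\pi\in\mathfrak S_n$ let $r\mathsf{Des}(\pi)=\{i\in[n-1] : \pi_i\ge \pi_{i+1}+r\}$ and $$r\mathsf{des}(\pi)=|r\mathsf{Des}(\pi)|,\qquad r\mathsf{maj}(\pi)=\sum_{i\in r\mathsf{Des}(\pi)} i+\bigl|\{(i,j) : i<j,\ \pi_j<\pi_i<\pi_j+r\}\bigr|.$$ For $g,\ell\ge 1$ let $$g\mathsf{exc}_\ell(\pi)=|\{i\in[n] : \pi_i\ge i+g,\ i\ge \ell\}|.$$ For $g,m\ge1$ let $g\mathsf{Excp}_m(\pi)=\{i\in[n-1] : \pi_i\ge i+g,\ \pi_i\ge m\}$, let $g\mathsf{Exc}_m(\pi)$ be the subword of $\pi$ formed by the letters $\pi_i$ with $i\in g\mathsf{Excp}_m(\pi)$, let $g\mathsf{Nexc}_m(\pi)$ be the subword formed by the remaining letters of $\pi$,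 and let $$g\mathsf{den}_m(\pi)=\sum_{i\in g\mathsf{Excp}_m(\pi)}(i+g-1)+\mathsf{inv}\bigl(g\mathsf{Exc}_m(\pi)\bigr)+\mathsf{inv}\bigl(g\mathsf{Nexc}_m(\pi)\bigr).$$ **Theorem.** For all integers $g,\ell\ge 1$, the pair $(g\mathsf{exc}_\ell,\ g\mathsf{den}_{g+\ell})$ is $(g+\ell-1)$-Euler-Mahonian; that is, with $r=g+\ell-1$, for every $n$, $$\sum_{\pi\in\mathfrak S_n}t^{\,g\mathsf{exc}_\ell(\pi)}q^{\,g\mathsf{den}_{g+\ell}(\pi)}=\sum_{\pi\in\mathfrak S_n}t^{\,r\mathsf{des}(\pi)}q^{\,r\mathsf{maj}(\pi)}.$$ -/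

import Mathlib

namespace PermStat

/-- A permutation of `[n] = {1, …, n}` is modelled by `π : Equiv.Perm (Fin n)`.
The index `i : Fin n` stands for the place `i + 1` of the one-line notation. -/
def place {n : ℕ} (i : Fin n) : ℕ := (i : ℕ) + 1

/-- The letter (an element of `{1, …, n}`) of `π` at the place of the index `i`. -/
def letter {n : ℕ} (π : Equiv.Perm (Fin n)) (i : Fin n) : ℕ := (π i : ℕ) + 1

/-- The inversion set: pairs of places `i < j` with `π_i > π_j`. -/
def invSet {n : ℕ} (π : Equiv.Perm (Fin n)) : Finset (Fin n × Fin n) :=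
  Finset.univ.filter fun p => p.1 < p.2 ∧ letter π p.2 < letter π p.1

/-- The number of inversions of the subword of `π` formed, in the order of their occurrence,
by the letters standing at the places in `S`. -/
def subwordInv {n : ℕ} (S : Finset (Fin n)) (π : Equiv.Perm (Fin n)) : ℕ :=
  ((invSet π).filter fun p => p.1 ∈ S ∧ p.2 ∈ S).card

/-- The `r`-descent set: places `i ∈ [n-1]` with `π_i ≥ π_{i+1} + r`. -/
def rDes (r : ℕ) {n : ℕ} (π : Equiv.Perm (Fin n)) : Finset (Fin n) :=
  Finset.univ.filter fun i =>
    ∃ h : (i : ℕ) + 1 < n, letter π ⟨(i : ℕ) + 1, h⟩ + r ≤ letter π i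

/-- The `r`-descent number. -/
def rdes (r : ℕ) {n : ℕ} (π : Equiv.Perm (Fin n)) : ℕ := (rDes r π).card

/-- The `r`-inversion set: inversions `(i, j)` with `π_i < π_j + r`. -/
def rInv (r : ℕ) {n : ℕ} (π : Equiv.Perm (Fin n)) : Finset (Fin n × Fin n) :=
  (invSet π).filter fun p => letter π p.1 < letter π p.2 + r

/-- The `r`-major index. -/
def rmaj (r : ℕ) {n : ℕ} (π : Equiv.Perm (Fin n)) : ℕ :=
  ∑ i ∈ rDes r π, place i + (rInv r π).card

/-- The set of `g`-gap `l`-level excedance places: `i ∈ [n-1]` with `π_i ≥ i + g`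
and `π_i ≥ l`. -/
def gExcp (g l : ℕ) {n : ℕ} (π : Equiv.Perm (Fin n)) : Finset (Fin n) :=
  Finset.univ.filter fun i => place i < n ∧ place i + g ≤ letter π i ∧ l ≤ letter π i

/-- The set of the places in `[n]` that are not `g`-gap `l`-level excedance places. -/
def gNexcp (g l : ℕ) {n : ℕ} (π : Equiv.Perm (Fin n)) : Finset (Fin n) := (gExcp g l π)ᶜ

/-- The `g`-gap `l`-level Denert's statistic. -/
def gden (g l : ℕ) {n : ℕ} (π : Equiv.Perm (Fin n)) : ℕ :=
  ∑ i ∈ gExcp g l π, (place i + g - 1)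
    + subwordInv (gExcp g l π) π + subwordInv (gNexcp g l π) π

/-- The `g`-gap `l`-level excedance number `|{i ∣ π_i ≥ i + g, i ≥ l}|`. -/
def gexc (g l : ℕ) {n : ℕ} (π : Equiv.Perm (Fin n)) : ℕ :=
  (Finset.univ.filter fun i : Fin n => place i + g ≤ letter π i ∧ l ≤ place i).card

/-- The joint generating polynomial `∑_π t^{st₁ π} q^{st₂ π}` over the permutations of `[n]`,
with `t = X 0` and `q = X 1`. -/
noncomputable def genPoly {n : ℕ} (st₁ st₂ : Equiv.Perm (Fin n) → ℕ) :
    MvPolynomial (Fin 2) ℤ :=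
  ∑ π : Equiv.Perm (Fin n), MvPolynomial.X 0 ^ st₁ π * MvPolynomial.X 1 ^ st₂ π

/-- The pair `(st₁, st₂)` is `r`-Euler-Mahonian over the permutations of `[n]`: it has the same
joint generating polynomial as the pair of the `r`-descent number and the `r`-major index. -/
def IsEulerMahonian (r n : ℕ) (st₁ st₂ : Equiv.Perm (Fin n) → ℕ) : Prop :=
  genPoly st₁ st₂ = genPoly (rdes (n := n) r) (rmaj (n := n) r)

end PermStat

/-! Write r = g + l - 1. Both pairs of statistics obey the same recursion in n. For r ≤ n, each σ in
S_n yields n + 1 permutations of [n+1], labelled c = 0, …, n. The label c adds c to the second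
statistic; it leaves the first one, st, unchanged if c < st(σ) + r and raises it by 1 otherwise. For
n ≤ r both pairs equal (0, inv), so the distributions agree for all n. The recursions are
`sum_rdes_rmaj_succ` and `sum_gexc_gden_succ`.

For (rdes, rmaj) the letter n+1 is inserted into one of the n + 1 gaps of σ. Exactly rdes(σ) + r
gaps are quiet, that is, create no new r-descent. Labelling the quiet gaps from right to left and
then the others from left to right gives the label as the increment of rmaj (`rmaj_insertMax`).

For (gexc, gden) a permutation is encoded by its excedance places I, the letters on I, and the word
N of the remaining letters. A word N is possible exactly when each letter y ≥ m in it is preceded in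
N by at least as many letters as there are places ≤ y - g outside I (`admissible_restWord`,
`excSet_eq_of_admissible`). The letter n+1 enters in one of three ways: - into N, with c < g letters
behind it: gden grows by c; - into the excedance letters in exchange for x, which moves to the
leftmost position that the bound above allows it in N: gden grows by g plus the number of excedance
letters greater than x; - at a new excedance place i: gden grows by g + |I| plus the number of free
places before i.

These increments run once through 0, …, n. Only a new place i ≥ l raises gexc, and `rank_lt_iff`
matches this with the threshold gexc(σ) + r. The insertions are jointly injective
(`isInsertion_inj`), hence bijective by counting. -/

namespace PermStat

open Finset

/-! ### One-line notation on the places 1, …, n -/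

/-- The one-line notation of `π` as a function of the place `p ∈ [n]`. -/
def word {n : ℕ} (π : Equiv.Perm (Fin n)) (p : ℕ) : ℕ :=
  -- Only p ∈ [n] matters: truncated subtraction gives p = 0 the value at 1, and 0 is a filler
  -- beyond n.
  if h : p - 1 < n then (π ⟨p - 1, h⟩ : ℕ) + 1 else 0

theorem word_place {n : ℕ} (π : Equiv.Perm (Fin n)) (i : Fin n) :
    word π (place i) = letter π i := by
  simp [word, place, letter]

theorem place_injective {n : ℕ} : Function.Injective (place (n := n)) := by
  intro i j h
  simp only [place] at h
  exact Fin.ext (by omega)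

theorem place_mem {n : ℕ} (i : Fin n) : place i ∈ Icc 1 n := by
  simp only [place, mem_Icc]
  omega

theorem exists_place {n p : ℕ} (hp : p ∈ Icc 1 n) : ∃ i : Fin n, place i = p := by
  rw [mem_Icc] at hp
  exact ⟨⟨p - 1, by omega⟩, by simp only [place]; omega⟩

theorem image_place_univ (n : ℕ) : (univ : Finset (Fin n)).image place = Icc 1 n := by
  ext p
  simp only [mem_image, mem_univ, true_and]
  exact ⟨fun ⟨i, h⟩ => h ▸ place_mem i, exists_place⟩

theorem word_mem {n : ℕ} (π : Equiv.Perm (Fin n)) {p : ℕ} (hp : p ∈ Icc 1 n) :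
    word π p ∈ Icc 1 n := by
  obtain ⟨i, rfl⟩ := exists_place hp
  rw [word_place]
  exact place_mem (π i)

theorem word_inj {n : ℕ} (π : Equiv.Perm (Fin n)) {p q : ℕ} (hp : p ∈ Icc 1 n)
    (hq : q ∈ Icc 1 n) (h : word π p = word π q) : p = q := by
  obtain ⟨i, rfl⟩ := exists_place hp
  obtain ⟨j, rfl⟩ := exists_place hq
  rw [word_place, word_place] at h
  have : π i = π j := place_injective h
  rw [π.injective this]

theorem word_ext {n : ℕ} {π π' : Equiv.Perm (Fin n)}
    (h : ∀ p ∈ Icc 1 n, word π p = word π' p) : π = π' := by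
  ext i
  have := h _ (place_mem i)
  rw [word_place, word_place] at this
  simpa [letter] using this

theorem exists_word {n : ℕ} (w : ℕ → ℕ) (hw : ∀ p ∈ Icc 1 n, w p ∈ Icc 1 n)
    (hinj : ∀ p ∈ Icc 1 n, ∀ q ∈ Icc 1 n, w p = w q → p = q) :
    ∃ π : Equiv.Perm (Fin n), ∀ p ∈ Icc 1 n, word π p = w p := by
  choose f hf using fun i : Fin n => exists_place (hw _ (place_mem i))
  have hfi : Function.Injective f := fun i j h =>
    place_injective (hinj _ (place_mem i) _ (place_mem j) (by rw [← hf i, ← hf j, h]))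
  refine ⟨Equiv.ofBijective f (Finite.injective_iff_bijective.mp hfi), fun p hp => ?_⟩
  obtain ⟨i, rfl⟩ := exists_place hp
  rw [word_place, ← hf i]
  rfl

theorem image_word {n : ℕ} (π : Equiv.Perm (Fin n)) : (Icc 1 n).image (word π) = Icc 1 n := by
  apply eq_of_subset_of_card_le
  · intro y hy
    obtain ⟨p, hp, rfl⟩ := mem_image.mp hy
    exact word_mem π hp
  · rw [card_image_of_injOn]
    intro p hp q hq h
    exact word_inj π hp hq h

theorem sum_image_place {n : ℕ} {M : Type*} [AddCommMonoid M] (S : Finset (Fin n)) (f : ℕ → M) :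
    ∑ i ∈ S, f (place i) = ∑ p ∈ S.image place, f p := by
  rw [sum_image fun _ _ _ _ h => place_injective h]

theorem card_image_place {n : ℕ} (S : Finset (Fin n)) : (S.image place).card = S.card :=
  card_image_of_injective _ place_injective

/-! ### Inversions of subwords and lists -/

/-- The number of inversions of `w` among the places in `C`. -/
def invOn (C : Finset ℕ) (w : ℕ → ℕ) : ℕ :=
  ∑ a ∈ C, ∑ b ∈ C, if a < b ∧ w b < w a then 1 else 0

theorem card_filter_pairs {n : ℕ} (S : Finset (Fin n)) (P : ℕ → ℕ → Prop)
    [∀ a b, Decidable (P a b)] :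
    ((univ : Finset (Fin n × Fin n)).filter
      fun p => (p.1 ∈ S ∧ p.2 ∈ S) ∧ P (place p.1) (place p.2)).card
      = ∑ a ∈ S.image place, ∑ b ∈ S.image place, if P a b then 1 else 0 := by
  rw [← sum_image_place S (fun a => ∑ b ∈ S.image place, if P a b then 1 else 0)]
  simp_rw [← sum_image_place S]
  rw [← sum_product', card_filter, ← sum_filter_add_sum_filter_not _ (fun p => p ∈ S ×ˢ S)]
  rw [add_eq_left.mpr]
  · rw [show (univ.filter fun p : Fin n × Fin n => p ∈ S ×ˢ S) = S ×ˢ S by ext; simp]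
    refine sum_congr rfl fun p hp => ?_
    rw [mem_product] at hp
    simp [hp]
  · refine sum_eq_zero fun p hp => ?_
    simp only [mem_filter, mem_univ, true_and, mem_product] at hp
    simp [hp]

theorem subwordInv_eq {n : ℕ} (S : Finset (Fin n)) (π : Equiv.Perm (Fin n)) :
    subwordInv S π = invOn (S.image place) (word π) := by
  rw [invOn, ← card_filter_pairs S fun a b => a < b ∧ word π b < word π a, subwordInv, invSet,
    filter_filter]
  congr 1
  ext p
  rw [mem_filter, mem_filter, word_place, word_place]
  have h : place p.1 < place p.2 ↔ p.1 < p.2 := by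
    rw [Fin.lt_def, place, place]
    omega
  rw [h]
  tauto

theorem invOn_congr {C : Finset ℕ} {w w' : ℕ → ℕ} (h : ∀ p ∈ C, w p = w' p) :
    invOn C w = invOn C w' :=
  sum_congr rfl fun a ha => sum_congr rfl fun b hb => by rw [h a ha, h b hb]

theorem invOn_insert {C : Finset ℕ} {a : ℕ} (ha : a ∉ C) (w : ℕ → ℕ) :
    invOn (insert a C) w = invOn C w + (∑ b ∈ C, if a < b ∧ w b < w a then 1 else 0)
      + ∑ b ∈ C, if b < a ∧ w a < w b then 1 else 0 := by
  simp only [invOn, sum_insert ha, sum_add_distrib]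
  simp
  ring

theorem invOn_union {C D : Finset ℕ} (h : ∀ a ∈ C, ∀ b ∈ D, a < b) (w : ℕ → ℕ) :
    invOn (C ∪ D) w = invOn C w + invOn D w
      + ∑ b ∈ D, (C.filter fun a => w b < w a).card := by
  have hd : Disjoint C D := disjoint_left.mpr fun a ha hb => lt_irrefl _ (h a ha a hb)
  simp only [invOn, sum_union hd, sum_add_distrib]
  have h1 : (∑ a ∈ D, ∑ b ∈ C, if a < b ∧ w b < w a then 1 else 0) = 0 :=
    sum_eq_zero fun a ha => sum_eq_zero fun b hb => if_neg fun h' => by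
      have := h b hb a ha
      omega
  have h2 : (∑ a ∈ C, ∑ b ∈ D, if a < b ∧ w b < w a then 1 else 0)
      = ∑ b ∈ D, (C.filter fun a => w b < w a).card := by
    rw [sum_comm]
    refine sum_congr rfl fun b hb => ?_
    rw [card_filter]
    refine sum_congr rfl fun a ha => ?_
    simp [h a ha b hb]
  rw [h1, h2]
  ring

/-- The number of inversions of a list. -/
def listInv : List ℕ → ℕ
  | [] => 0
  | a :: l => l.countP (· < a) + listInv l

theorem listInv_insertIdx (l : List ℕ) (t x : ℕ) (ht : t ≤ l.length) :
    listInv (l.insertIdx t x)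
      = listInv l + (l.take t).countP (x < ·) + (l.drop t).countP (· < x) := by
  induction l generalizing t with
  | nil => 
    obtain rfl : t = 0 := by simpa using ht
    simp [listInv]
  | cons a l ih =>
    cases t with
    | zero => simp [listInv]; ring
    | succ t =>
      have ht' : t ≤ l.length := by simpa using ht
      have hp := (List.perm_insertIdx x l ht').countP_eq (· < a)
      simp only [List.insertIdx_succ_cons, listInv, ih t ht', hp, List.countP_cons,
        List.take_succ_cons, List.drop_succ_cons]
      ring

theorem invOn_toFinset (P : List ℕ) (hP : P.Pairwise (· < ·)) (w : ℕ → ℕ) :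
    invOn P.toFinset w = listInv (P.map w) := by
  induction P with
  | nil => rfl
  | cons a P ih =>
    rw [List.pairwise_cons] at hP
    have ha : a ∉ P.toFinset := fun h => lt_irrefl _ (hP.1 a (by simpa using h))
    have hnd : P.Nodup := hP.2.imp fun h => h.ne
    rw [List.toFinset_cons, invOn_insert ha, ih hP.2, List.map_cons, listInv]
    have h1 : (∑ b ∈ P.toFinset, if a < b ∧ w b < w a then 1 else 0)
        = (P.map w).countP (· < w a) := by
      rw [List.countP_map, ← card_filter, List.countP_eq_length_filter,
        ← List.toFinset_card_of_nodup (hnd.filter _)]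
      congr 1
      ext b
      simp only [mem_filter, List.mem_toFinset, List.mem_filter, Function.comp, decide_eq_true_eq]
      exact ⟨fun h => ⟨h.1, h.2.2⟩, fun h => ⟨h.1, hP.1 b h.1, h.2⟩⟩
    have h2 : (∑ b ∈ P.toFinset, if b < a ∧ w a < w b then 1 else 0) = 0 :=
      sum_eq_zero fun b hb => if_neg fun h => by
        have := hP.1 b (by simpa using hb)
        omega
    rw [h1, h2]
    ring

/-! ### Relabelling by rank and summation over insertions -/

/-- Ranks from the left run once through 0, …, |S| - 1. This turns a sum over slots into a sum over
labels; `sum_rank_gt` does so from the right. -/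
theorem sum_rank_lt {M : Type*} [AddCommMonoid M] (S : Finset ℕ) (G : ℕ → M) :
    ∑ i ∈ S, G (S.filter (· < i)).card = ∑ c ∈ range S.card, G c := by
  induction S using Finset.induction_on_max with
  | empty => simp
  | insert a S ha ih =>
    have hn : a ∉ S := fun h => lt_irrefl _ (ha a h)
    rw [sum_insert hn, card_insert_of_notMem hn, sum_range_succ, add_comm, ← ih]
    congr 1
    · refine sum_congr rfl fun i hi => ?_
      rw [filter_insert, if_neg (ha i hi).not_gt]
    · rw [filter_insert, if_neg (lt_irrefl a), filter_true_of_mem ha]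

theorem sum_rank_gt {M : Type*} [AddCommMonoid M] (S : Finset ℕ) (G : ℕ → M) :
    ∑ i ∈ S, G (S.filter (i < ·)).card = ∑ c ∈ range S.card, G c := by
  induction S using Finset.induction_on_min with
  | empty => simp
  | insert a S ha ih =>
    have hn : a ∉ S := fun h => lt_irrefl _ (ha a h)
    rw [sum_insert hn, card_insert_of_notMem hn, sum_range_succ, add_comm, ← ih]
    congr 1
    · refine sum_congr rfl fun i hi => ?_
      rw [filter_insert, if_neg (ha i hi).not_gt]
    · rw [filter_insert, if_neg (lt_irrefl a), filter_true_of_mem ha]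

/-- Surjectivity is free: an injective family of (n + 1) · n! permutations exhausts S_{n+1}. -/
theorem sum_perm_succ {M ι : Type*} [AddCommMonoid M] {n : ℕ}
    (T : Equiv.Perm (Fin n) → Finset ι) (hT : ∀ σ, (T σ).card = n + 1)
    (Φ : Equiv.Perm (Fin n) → ι → Equiv.Perm (Fin (n + 1)))
    (hΦ : ∀ σ, ∀ s ∈ T σ, ∀ σ', ∀ s' ∈ T σ', Φ σ s = Φ σ' s' → σ = σ' ∧ s = s')
    (f : Equiv.Perm (Fin (n + 1)) → M) :
    ∑ π, f π = ∑ σ, ∑ s ∈ T σ, f (Φ σ s) := by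
  classical
  have hinj : Set.InjOn (fun x : (Σ _ : Equiv.Perm (Fin n), ι) => Φ x.1 x.2)
      (univ.sigma T : Finset _) := by
    rintro ⟨σ, s⟩ h ⟨σ', s'⟩ h' he
    simp only [coe_sigma, Set.mem_sigma_iff, mem_coe, mem_univ, true_and] at h h'
    obtain ⟨rfl, rfl⟩ := hΦ σ s h σ' s' h' he
    rfl
  rw [sum_sigma', ← sum_image (f := f) (g := fun x : (Σ _ : Equiv.Perm (Fin n), ι) => Φ x.1 x.2)
    hinj]
  congr 1
  symm
  apply eq_univ_of_card
  rw [card_image_of_injOn hinj, card_sigma]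
  simp only [hT, sum_const, card_univ, Fintype.card_perm, Fintype.card_fin, smul_eq_mul,
    Nat.factorial_succ]
  ring

/-! ### r-descents and r-inversions on words -/

/-- The `r`-descent places of the word `w` of length `n`. -/
def desSet (r n : ℕ) (w : ℕ → ℕ) : Finset ℕ :=
  (Icc 1 n).filter fun p => p + 1 ≤ n ∧ w (p + 1) + r ≤ w p

theorem mem_desSet {r n : ℕ} {w : ℕ → ℕ} {p : ℕ} :
    p ∈ desSet r n w ↔ 1 ≤ p ∧ p + 1 ≤ n ∧ w (p + 1) + r ≤ w p := by
  simp only [desSet, mem_filter, mem_Icc]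
  constructor
  · rintro ⟨⟨h1, -⟩, h2⟩
    exact ⟨h1, h2⟩
  · rintro ⟨h1, h2, h3⟩
    exact ⟨⟨h1, by omega⟩, h2, h3⟩

theorem image_place_rDes (r : ℕ) {n : ℕ} (π : Equiv.Perm (Fin n)) :
    (rDes r π).image place = desSet r n (word π) := by
  ext p
  simp only [mem_image, rDes, mem_filter, mem_univ, true_and, mem_desSet]
  constructor
  · rintro ⟨i, ⟨h, hi⟩, rfl⟩
    refine ⟨(mem_Icc.mp (place_mem i)).1, h, ?_⟩
    rw [word_place]
    convert hi using 2
    exact word_place π ⟨i + 1, h⟩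
  · rintro ⟨h1, h2, h3⟩
    obtain ⟨i, rfl⟩ := exists_place (n := n) (p := p) (mem_Icc.mpr ⟨h1, by omega⟩)
    refine ⟨i, ⟨h2, ?_⟩, rfl⟩
    rw [word_place] at h3
    convert h3 using 2
    exact (word_place π ⟨i + 1, h2⟩).symm

theorem rdes_eq (r : ℕ) {n : ℕ} (π : Equiv.Perm (Fin n)) :
    rdes r π = (desSet r n (word π)).card := by
  rw [← image_place_rDes, card_image_place, rdes]

theorem rmaj_eq (r : ℕ) {n : ℕ} (π : Equiv.Perm (Fin n)) :
    rmaj r π = ∑ p ∈ desSet r n (word π), p + ∑ a ∈ Icc 1 n, ∑ b ∈ Icc 1 n,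
      if a < b ∧ word π b < word π a ∧ word π a < word π b + r then 1 else 0 := by
  rw [rmaj, sum_image_place _ fun p => p, image_place_rDes, ← image_place_univ,
    ← card_filter_pairs univ fun a b =>
      a < b ∧ word π b < word π a ∧ word π a < word π b + r]
  congr 2
  ext p
  have h : place p.1 < place p.2 ↔ p.1 < p.2 := by
    rw [Fin.lt_def, place, place]
    omega
  simp only [rInv, invSet, mem_filter, mem_univ, true_and, word_place, h]
  tauto

/-! ### Insertion of the greatest letter into a gap -/

/-- The place, after the insertion of a letter between the places `i` and `i + 1`, of the letter
at the place `p`. -/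
def shift (i p : ℕ) : ℕ := if p ≤ i then p else p + 1

theorem shift_lt_shift {i p q : ℕ} : shift i p < shift i q ↔ p < q := by
  simp only [shift]
  split_ifs <;> omega

theorem shift_injective (i : ℕ) : Function.Injective (shift i) := by
  intro p q h
  simp only [shift] at h
  split_ifs at h <;> omega

theorem Icc_succ_eq_insert {n i : ℕ} (hi : i ≤ n) :
    Icc 1 (n + 1) = insert (i + 1) ((Icc 1 n).image (shift i)) := by
  ext p
  simp only [mem_Icc, mem_insert, mem_image, shift]
  constructor
  · intro hp
    rcases lt_trichotomy p (i + 1) with h | h | h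
    · exact Or.inr ⟨p, by omega, if_pos (by omega)⟩
    · exact Or.inl h
    · exact Or.inr ⟨p - 1, by omega, by rw [if_neg (by omega)]; omega⟩
  · rintro (rfl | ⟨q, hq, rfl⟩)
    · omega
    · split_ifs <;> omega

theorem notMem_image_shift (i : ℕ) (C : Finset ℕ) : i + 1 ∉ C.image (shift i) := by
  simp only [mem_image, shift, not_exists, not_and]
  intro p _ h
  split_ifs at h <;> omega

theorem exists_insert_max {n : ℕ} (σ : Equiv.Perm (Fin n)) {i : ℕ} (hi : i ≤ n) :
    ∃ π : Equiv.Perm (Fin (n + 1)), word π (i + 1) = n + 1 ∧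
      ∀ p ∈ Icc 1 n, word π (shift i p) = word σ p := by
  obtain ⟨π, hπ⟩ := exists_word (n := n + 1)
    (fun p => if p = i + 1 then n + 1 else word σ (if p ≤ i then p else p - 1)) (by
      intro p hp
      rw [mem_Icc] at hp
      by_cases hpi : p = i + 1
      · rw [if_pos hpi, mem_Icc]
        omega
      · have := mem_Icc.mp (word_mem σ (p := if p ≤ i then p else p - 1)
          (mem_Icc.mpr (by split_ifs <;> omega)))
        rw [if_neg hpi, mem_Icc]
        omega) (by
      intro p hp q hq h
      rw [mem_Icc] at hp hq
      have key : ∀ p, 1 ≤ p ∧ p ≤ n + 1 → p ≠ i + 1 → (if p ≤ i then p else p - 1) ∈ Icc 1 n := by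
        intro p hp hne
        rw [mem_Icc]
        split_ifs <;> omega
      by_cases h1 : p = i + 1 <;> by_cases h2 : q = i + 1
      · omega
      · have := mem_Icc.mp (word_mem σ (key q hq h2))
        rw [if_pos h1, if_neg h2] at h
        omega
      · have := mem_Icc.mp (word_mem σ (key p hp h1))
        rw [if_neg h1, if_pos h2] at h
        omega
      · rw [if_neg h1, if_neg h2] at h
        have := word_inj σ (key p hp h1) (key q hq h2) h
        split_ifs at this <;> omega)
  refine ⟨π, ?_, fun p hp => ?_⟩
  · rw [hπ _ (mem_Icc.mpr ⟨by omega, by omega⟩), if_pos rfl]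
  · rw [mem_Icc] at hp
    simp only [shift]
    split_ifs with h
    · rw [hπ _ (mem_Icc.mpr ⟨by omega, by omega⟩), if_neg (by omega), if_pos h]
    · rw [hπ _ (mem_Icc.mpr ⟨by omega, by omega⟩), if_neg (by omega), if_neg (by omega)]
      rfl

/-- The permutation obtained from `σ` by inserting its new greatest letter after the place `i`. -/
noncomputable def insertMax {n : ℕ} (σ : Equiv.Perm (Fin n)) (i : ℕ) :
    Equiv.Perm (Fin (n + 1)) :=
  if h : i ≤ n then (exists_insert_max σ h).choose else 1

theorem word_insertMax_self {n : ℕ} (σ : Equiv.Perm (Fin n)) {i : ℕ} (hi : i ≤ n) :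
    word (insertMax σ i) (i + 1) = n + 1 := by
  rw [insertMax, dif_pos hi]
  exact (exists_insert_max σ hi).choose_spec.1

theorem word_insertMax_shift {n : ℕ} (σ : Equiv.Perm (Fin n)) {i : ℕ} (hi : i ≤ n) {p : ℕ}
    (hp : p ∈ Icc 1 n) : word (insertMax σ i) (shift i p) = word σ p := by
  rw [insertMax, dif_pos hi]
  exact (exists_insert_max σ hi).choose_spec.2 p hp

theorem insertMax_injective {n : ℕ} {σ σ' : Equiv.Perm (Fin n)} {i j : ℕ} (hi : i ≤ n)
    (hj : j ≤ n) (h : insertMax σ i = insertMax σ' j) : σ = σ' ∧ i = j := by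
  have hij : i = j := by
    have h1 := word_insertMax_self σ hi
    have h2 := (h ▸ h1).trans (word_insertMax_self σ' hj).symm
    have := word_inj (insertMax σ' j) (mem_Icc.mpr ⟨by omega, by omega⟩) (mem_Icc.mpr ⟨by omega, by omega⟩) h2
    omega
  subst hij
  refine ⟨word_ext fun p hp => ?_, rfl⟩
  rw [← word_insertMax_shift σ hi hp, h, word_insertMax_shift σ' hi hp]

/-- The new letter destroys a descent at i, since it is an ascent top there, and is itself a descent
top at i + 1 when the next letter is small enough. All other adjacent pairs are only shifted. -/
theorem desSet_insertMax (r : ℕ) (hr : 1 ≤ r) {n : ℕ} (σ : Equiv.Perm (Fin n)) {i : ℕ}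
    (hi : i ≤ n) :
    desSet r (n + 1) (word (insertMax σ i)) = ((desSet r n (word σ)).erase i).image (shift i) ∪
      if i < n ∧ word σ (i + 1) + r ≤ n + 1 then {i + 1} else ∅ := by
  have h0 := word_insertMax_self σ hi
  have hlo : ∀ p, 1 ≤ p → p ≤ i → word (insertMax σ i) p = word σ p := fun p h1 h2 => by
    rw [← word_insertMax_shift σ hi (mem_Icc.mpr ⟨h1, by omega⟩), shift, if_pos h2]
  have hhi : ∀ p, i < p → p ≤ n → word (insertMax σ i) (p + 1) = word σ p := fun p h1 h2 => by
    rw [← word_insertMax_shift σ hi (mem_Icc.mpr ⟨by omega, h2⟩), shift, if_neg (by omega)]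
  ext p
  rw [mem_union, mem_image, mem_desSet]
  rcases lt_trichotomy p (i + 1) with h | rfl | h
  · have e1 : p ∈ (if i < n ∧ word σ (i + 1) + r ≤ n + 1 then ({i + 1} : Finset ℕ) else ∅)
        ↔ False := by
      split_ifs <;> simp; omega
    rw [e1, or_false]
    constructor
    · rintro ⟨h1, h2, h3⟩
      rw [hlo p h1 (by omega)] at h3
      have hpi : p ≠ i := by
        rintro rfl
        have := mem_Icc.mp (word_mem σ (p := p) (mem_Icc.mpr ⟨h1, hi⟩))
        omega
      rw [hlo (p + 1) (by omega) (by omega)] at h3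
      exact ⟨p, mem_erase.mpr ⟨hpi, mem_desSet.mpr ⟨h1, by omega, h3⟩⟩, if_pos (by omega)⟩
    · rintro ⟨q, hq, hqp⟩
      rw [mem_erase, mem_desSet] at hq
      obtain ⟨hqi, h1, h2, h3⟩ := hq
      simp only [shift] at hqp
      split_ifs at hqp
      · subst hqp
        rw [hlo q h1 (by omega), hlo (q + 1) (by omega) (by omega)]
        exact ⟨h1, by omega, h3⟩
      · omega
  · have e2 : ¬ ∃ a ∈ (desSet r n (word σ)).erase i, shift i a = i + 1 := by
      have := notMem_image_shift i ((desSet r n (word σ)).erase i)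
      rwa [mem_image] at this
    rw [or_iff_right e2, h0]
    constructor
    · rintro ⟨-, h2, h3⟩
      rw [hhi (i + 1) (by omega) (by omega)] at h3
      rw [if_pos ⟨by omega, h3⟩]
      simp
    · intro h
      split_ifs at h with hc
      · rw [hhi (i + 1) (by omega) (by omega)]
        exact ⟨by omega, by omega, hc.2⟩
      · simp at h
  · have e1 : p ∈ (if i < n ∧ word σ (i + 1) + r ≤ n + 1 then ({i + 1} : Finset ℕ) else ∅)
        ↔ False := by
      split_ifs <;> simp; omega
    rw [e1, or_false]
    obtain ⟨p, rfl⟩ : ∃ q, p = q + 1 := ⟨p - 1, by omega⟩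
    constructor
    · rintro ⟨h1, h2, h3⟩
      rw [hhi p (by omega) (by omega), hhi (p + 1) (by omega) (by omega)] at h3
      exact ⟨p, mem_erase.mpr ⟨by omega, mem_desSet.mpr ⟨by omega, by omega, h3⟩⟩,
        if_neg (by omega)⟩
    · rintro ⟨q, hq, hqp⟩
      rw [mem_erase, mem_desSet] at hq
      obtain ⟨hqi, h1, h2, h3⟩ := hq
      simp only [shift] at hqp
      split_ifs at hqp
      · omega
      · obtain rfl : q = p := by omega
        rw [hhi q (by omega) (by omega), hhi (q + 1) (by omega) (by omega)]
        exact ⟨by omega, by omega, h3⟩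

theorem sum_desSet_insertMax (r : ℕ) (hr : 1 ≤ r) {n : ℕ} (σ : Equiv.Perm (Fin n)) {i : ℕ}
    (hi : i ≤ n) (f : ℕ → ℕ) :
    ∑ p ∈ desSet r (n + 1) (word (insertMax σ i)), f p =
      ∑ p ∈ (desSet r n (word σ)).erase i, f (shift i p) +
        if i < n ∧ word σ (i + 1) + r ≤ n + 1 then f (i + 1) else 0 := by
  rw [desSet_insertMax r hr σ hi, sum_union, sum_image fun _ _ _ _ h => shift_injective i h]
  · congr 1
    split_ifs <;> simp
  · split_ifs
    · exact disjoint_singleton_right.mpr (notMem_image_shift i _)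
    · exact disjoint_empty_right _

/-- The greatest letter can only be the larger member of an inversion, so the new pairs are those
with a later letter exceeding n + 1 - r. -/
theorem rInv_insertMax (r : ℕ) {n : ℕ} (σ : Equiv.Perm (Fin n)) {i : ℕ} (hi : i ≤ n) :
    (∑ a ∈ Icc 1 (n + 1), ∑ b ∈ Icc 1 (n + 1),
      if a < b ∧ word (insertMax σ i) b < word (insertMax σ i) a ∧
        word (insertMax σ i) a < word (insertMax σ i) b + r then 1 else 0) =
    (∑ a ∈ Icc 1 n, ∑ b ∈ Icc 1 n,
      if a < b ∧ word σ b < word σ a ∧ word σ a < word σ b + r then 1 else 0) +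
      ((Icc 1 n).filter fun b => i < b ∧ n + 1 < word σ b + r).card := by
  simp only [Icc_succ_eq_insert hi, sum_insert (notMem_image_shift i _),
    sum_image fun _ _ _ _ h => shift_injective i h, word_insertMax_self σ hi, sum_add_distrib]
  have h1 : (∑ b ∈ Icc 1 n, if i + 1 < shift i b ∧ word (insertMax σ i) (shift i b) < n + 1 ∧
      n + 1 < word (insertMax σ i) (shift i b) + r then 1 else 0)
      = ((Icc 1 n).filter fun b => i < b ∧ n + 1 < word σ b + r).card := by
    rw [card_filter]
    refine sum_congr rfl fun b hb => ?_
    rw [word_insertMax_shift σ hi hb]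
    have := mem_Icc.mp (word_mem σ hb)
    refine if_congr ?_ rfl rfl
    simp only [shift]
    split_ifs <;> omega
  have h2 : (∑ a ∈ Icc 1 n, if shift i a < i + 1 ∧ n + 1 < word (insertMax σ i) (shift i a) ∧
      word (insertMax σ i) (shift i a) < n + 1 + r then 1 else 0) = 0 := by
    refine sum_eq_zero fun a ha => if_neg ?_
    rw [word_insertMax_shift σ hi ha]
    have := mem_Icc.mp (word_mem σ ha)
    omega
  have h3 : (∑ a ∈ Icc 1 n, ∑ b ∈ Icc 1 n,
      if shift i a < shift i b ∧ word (insertMax σ i) (shift i b) < word (insertMax σ i) (shift i a)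
        ∧ word (insertMax σ i) (shift i a) < word (insertMax σ i) (shift i b) + r then 1 else 0)
      = ∑ a ∈ Icc 1 n, ∑ b ∈ Icc 1 n,
      if a < b ∧ word σ b < word σ a ∧ word σ a < word σ b + r then 1 else 0 := by
    refine sum_congr rfl fun a ha => sum_congr rfl fun b hb => ?_
    rw [word_insertMax_shift σ hi ha, word_insertMax_shift σ hi hb]
    exact if_congr (and_congr_left' shift_lt_shift) rfl rfl
  rw [h1, h2, h3]
  simp
  ring

/-! ### Quiet gaps and the recursion for (rdes, rmaj) -/

/-- The places `i` such that the insertion of the new greatest letter after the place `i` creates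
no new `r`-descent. -/
def quietSlots (r n : ℕ) (w : ℕ → ℕ) : Finset ℕ :=
  (range (n + 1)).filter fun i => i = n ∨ i ∈ desSet r n w ∨ n + 1 < w (i + 1) + r

/-- The three reasons to be quiet exclude each other: after an r-descent the next letter is at most
n - r. The predicate `P` serves both for the total count and for the count to the right of a gap. -/
theorem card_filter_quietSlots (r : ℕ) {n : ℕ} (σ : Equiv.Perm (Fin n))
    (P : ℕ → Prop) [DecidablePred P] :
    ((quietSlots r n (word σ)).filter P).card = ((desSet r n (word σ)).filter P).card
      + ((range n).filter fun i => n + 1 < word σ (i + 1) + r ∧ P i).card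
      + if P n then 1 else 0 := by
  have hq : (quietSlots r n (word σ)).filter P = (((desSet r n (word σ)).filter P) ∪
      ((range n).filter fun i => n + 1 < word σ (i + 1) + r ∧ P i)) ∪
      if P n then {n} else ∅ := by
    ext i
    have e1 : i ∈ (if P n then ({n} : Finset ℕ) else ∅) ↔ P n ∧ i = n := by
      split_ifs with h <;> simp [h]
    have e2 : i ∈ desSet r n (word σ) → i < n := fun h => by
      have := mem_desSet.mp h
      omega
    simp only [quietSlots, mem_filter, mem_union, e1, mem_range]
    constructor
    · rintro ⟨⟨h1, h2⟩, h3⟩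
      by_cases hn : i = n
      · subst hn; exact Or.inr ⟨h3, rfl⟩
      · rcases h2 with h | h | h
        · exact absurd h hn
        · exact Or.inl (Or.inl ⟨h, h3⟩)
        · exact Or.inl (Or.inr ⟨by omega, h, h3⟩)
    · rintro ((h | h) | ⟨h, rfl⟩)
      · exact ⟨⟨by have := e2 h.1; omega, Or.inr (Or.inl h.1)⟩, h.2⟩
      · exact ⟨⟨by omega, Or.inr (Or.inr h.2.1)⟩, h.2.2⟩
      · exact ⟨⟨by omega, Or.inl rfl⟩, h⟩
  rw [hq, card_union_of_disjoint, card_union_of_disjoint]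
  · congr 1
    split_ifs <;> simp
  · rw [disjoint_left]
    intro i h1 h2
    rw [mem_filter, mem_desSet] at h1
    rw [mem_filter] at h2
    have := mem_Icc.mp (word_mem σ (p := i) (mem_Icc.mpr ⟨h1.1.1, by omega⟩))
    omega
  · rw [disjoint_left]
    intro i h1 h2
    have hin : i = n := by
      by_contra hne
      split_ifs at h2 <;> simp_all
    rw [mem_union, mem_filter, mem_filter, mem_desSet, mem_range] at h1
    omega

theorem card_quietSlots (r : ℕ) (hr : 1 ≤ r) {n : ℕ} (hn : r ≤ n) (σ : Equiv.Perm (Fin n)) :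
    (quietSlots r n (word σ)).card = rdes r σ + r := by
  have h := card_filter_quietSlots r σ fun _ => True
  simp only [filter_true, and_true, if_true] at h
  have hb : ((range n).filter fun i => n + 1 < word σ (i + 1) + r).card = r - 1 := by
    -- The letters concerned are n + 2 - r, …, n; there are r - 1 of them because r ≤ n.
    have : ((range n).filter fun i => n + 1 < word σ (i + 1) + r).image (fun i => word σ (i + 1))
        = Icc (n + 2 - r) n := by
      ext y
      simp only [mem_image, mem_filter, mem_range, mem_Icc]
      constructor
      · rintro ⟨i, ⟨h1, h2⟩, rfl⟩
        have := mem_Icc.mp (word_mem σ (p := i + 1) (mem_Icc.mpr ⟨by omega, by omega⟩))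
        omega
      · intro hy
        have : y ∈ (Icc 1 n).image (word σ) := by
          rw [image_word, mem_Icc]
          omega
        obtain ⟨p, hp, rfl⟩ := mem_image.mp this
        rw [mem_Icc] at hp
        obtain ⟨p, rfl⟩ : ∃ q, p = q + 1 := ⟨p - 1, by omega⟩
        exact ⟨p, ⟨by omega, by omega⟩, rfl⟩
    rw [← card_image_of_injOn (f := fun i => word σ (i + 1)), this, Nat.card_Icc]
    · omega
    · intro a ha b hb hab
      simp only [coe_filter, mem_range, Set.mem_ofPred_eq] at ha hb
      have := word_inj σ (mem_Icc.mpr ⟨by omega, by omega⟩) (mem_Icc.mpr ⟨by omega, by omega⟩) hab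
      omega
  rw [h, hb, rdes_eq]
  omega

theorem rdes_insertMax (r : ℕ) (hr : 1 ≤ r) {n : ℕ} (σ : Equiv.Perm (Fin n)) {i : ℕ}
    (hi : i ≤ n) :
    rdes r (insertMax σ i) = if i ∈ quietSlots r n (word σ) then rdes r σ else rdes r σ + 1 := by
  have h := sum_desSet_insertMax r hr σ hi fun _ => 1
  rw [← card_eq_sum_ones, ← card_eq_sum_ones, ← rdes_eq] at h
  rw [h, rdes_eq]
  by_cases hd : i ∈ desSet r n (word σ)
  · have h1 := card_erase_add_one hd
    have hd' := mem_desSet.mp hd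
    have := mem_Icc.mp (word_mem σ (p := i) (mem_Icc.mpr ⟨by omega, by omega⟩))
    rw [if_pos ⟨by omega, by omega⟩, if_pos, h1]
    simp only [quietSlots, mem_filter, mem_range]
    exact ⟨by omega, Or.inr (Or.inl hd)⟩
  · rw [erase_eq_of_notMem hd]
    simp only [quietSlots, mem_filter, mem_range, hd, false_or]
    split_ifs <;> omega

/-- Each quiet gap to the right of i contributes 1: an r-descent is shifted by one, a letter
exceeding n + 1 - r forms an r-inversion with n + 1. The final gap accounts for the remaining unit
when i < n: a descent at i moving to i + 1, the r-inversion with the letter directly behind n + 1,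
or the difference between i + 1 and i for a new descent. -/
theorem rmaj_insertMax (r : ℕ) (hr : 1 ≤ r) {n : ℕ} (σ : Equiv.Perm (Fin n)) {i : ℕ}
    (hi : i ≤ n) :
    rmaj r (insertMax σ i) = rmaj r σ + (if i ∈ quietSlots r n (word σ) then 0 else i)
      + ((quietSlots r n (word σ)).filter (i < ·)).card := by
  rw [rmaj_eq, rInv_insertMax r σ hi, sum_desSet_insertMax r hr σ hi fun p => p, rmaj_eq,
    card_filter_quietSlots r]
  have hsh : ∑ p ∈ (desSet r n (word σ)).erase i, shift i p
      = ∑ p ∈ (desSet r n (word σ)).erase i, p + ((desSet r n (word σ)).filter (i < ·)).card := by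
    have : (desSet r n (word σ)).filter (i < ·)
        = ((desSet r n (word σ)).erase i).filter (i < ·) := by
      ext p
      simp only [mem_filter, mem_erase]
      constructor
      · rintro ⟨h1, h2⟩
        exact ⟨⟨by omega, h1⟩, h2⟩
      · rintro ⟨⟨-, h1⟩, h2⟩
        exact ⟨h1, h2⟩
    rw [this, card_filter, ← sum_add_distrib]
    refine sum_congr rfl fun p _ => ?_
    simp only [shift]
    split_ifs <;> omega
  have hb : ((Icc 1 n).filter fun b => i < b ∧ n + 1 < word σ b + r).card
      = ((range n).filter fun j => n + 1 < word σ (j + 1) + r ∧ i < j).card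
        + if i < n ∧ n + 1 < word σ (i + 1) + r then 1 else 0 := by
    have e1 : (Icc 1 n).filter (fun b => i < b ∧ n + 1 < word σ b + r)
        = ((range n).filter fun j => n + 1 < word σ (j + 1) + r ∧ i ≤ j).image (· + 1) := by
      ext b
      simp only [mem_filter, mem_Icc, mem_image, mem_range]
      constructor
      · rintro ⟨h1, h2, h3⟩
        obtain ⟨b, rfl⟩ : ∃ q, b = q + 1 := ⟨b - 1, by omega⟩
        exact ⟨b, ⟨by omega, h3, by omega⟩, rfl⟩
      · rintro ⟨j, ⟨h1, h2, h3⟩, rfl⟩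
        exact ⟨by omega, by omega, h2⟩
    have e2 : (range n).filter (fun j => n + 1 < word σ (j + 1) + r ∧ i ≤ j)
        = ((range n).filter fun j => n + 1 < word σ (j + 1) + r ∧ i < j) ∪
          if i < n ∧ n + 1 < word σ (i + 1) + r then {i} else ∅ := by
      ext j
      have e3 : j ∈ (if i < n ∧ n + 1 < word σ (i + 1) + r then ({i} : Finset ℕ) else ∅)
          ↔ (i < n ∧ n + 1 < word σ (i + 1) + r) ∧ j = i := by
        split_ifs with h <;> simp [h]
      rw [mem_union, e3, mem_filter, mem_filter, mem_range]
      constructor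
      · rintro ⟨h1, h2, h3⟩
        rcases h3.lt_or_eq with h | rfl
        · exact Or.inl ⟨h1, h2, h⟩
        · exact Or.inr ⟨⟨h1, h2⟩, rfl⟩
      · rintro (⟨h1, h2, h3⟩ | ⟨⟨h1, h2⟩, rfl⟩)
        · exact ⟨h1, h2, h3.le⟩
        · exact ⟨h1, h2, le_rfl⟩
    rw [e1, card_image_of_injective _ (add_left_injective 1), e2, card_union_of_disjoint]
    · congr 1
      split_ifs <;> simp
    · rw [disjoint_left]
      intro j h1 h2
      rw [mem_filter] at h1
      split_ifs at h2
      · rw [mem_singleton] at h2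
        omega
      · simp at h2
  rw [hsh, hb]
  by_cases hd : i ∈ desSet r n (word σ)
  · have h1 := sum_erase_add (f := fun p => p) _ hd
    have hd' := mem_desSet.mp hd
    have := mem_Icc.mp (word_mem σ (p := i) (mem_Icc.mpr ⟨by omega, by omega⟩))
    have hq : i ∈ quietSlots r n (word σ) := by
      simp only [quietSlots, mem_filter, mem_range]
      exact ⟨by omega, Or.inr (Or.inl hd)⟩
    rw [if_pos ⟨by omega, by omega⟩, if_pos hq, if_neg (by omega), if_pos (by omega), ← h1]
    ring
  · rw [erase_eq_of_notMem hd]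
    have hq : i ∈ quietSlots r n (word σ) ↔ i = n ∨ n + 1 < word σ (i + 1) + r := by
      simp only [quietSlots, mem_filter, mem_range, hd, false_or]
      exact ⟨fun h => h.2, fun h => ⟨by omega, h⟩⟩
    by_cases hin : i = n
    · rw [if_pos (hq.mpr (Or.inl hin)), if_neg (by omega), if_neg (by omega), if_neg (by omega)]
      ring
    · by_cases hbig : n + 1 < word σ (i + 1) + r
      · rw [if_pos (hq.mpr (Or.inr hbig)), if_neg (by omega), if_pos ⟨by omega, hbig⟩,
          if_pos (by omega)]
        ring
      · rw [if_neg (fun h => (hq.mp h).elim hin hbig), if_pos ⟨by omega, by omega⟩,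
          if_neg (by omega), if_pos (by omega)]
        ring

theorem sum_rdes_rmaj_succ {M : Type*} [AddCommMonoid M] (r : ℕ) (hr : 1 ≤ r) {n : ℕ}
    (hn : r ≤ n) (f : ℕ → ℕ → M) :
    ∑ π : Equiv.Perm (Fin (n + 1)), f (rdes r π) (rmaj r π) =
      ∑ σ : Equiv.Perm (Fin n), ∑ c ∈ range (n + 1),
        f (if c < rdes r σ + r then rdes r σ else rdes r σ + 1) (rmaj r σ + c) := by
  rw [sum_perm_succ (fun _ => range (n + 1)) (by simp) insertMax]
  · refine sum_congr rfl fun σ _ => ?_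
    have hS := card_quietSlots r hr hn σ
    set S := quietSlots r n (word σ) with hSdef
    have hsub : S ⊆ range (n + 1) := filter_subset _ _
    have hle : S.card ≤ n + 1 := by simpa using card_le_card hsub
    rw [← sum_sdiff hsub, add_comm]
    have h1 : ∑ i ∈ S, f (rdes r (insertMax σ i)) (rmaj r (insertMax σ i))
        = ∑ c ∈ range S.card, f (rdes r σ) (rmaj r σ + c) := by
      rw [← sum_rank_gt S fun c => f (rdes r σ) (rmaj r σ + c)]
      refine sum_congr rfl fun i hi => ?_
      have hin : i ≤ n := by
        have := mem_range.mp (hsub hi)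
        omega
      rw [rdes_insertMax r hr σ hin, rmaj_insertMax r hr σ hin, if_pos hi, if_pos hi, add_zero]
    have h2 : ∑ i ∈ range (n + 1) \ S, f (rdes r (insertMax σ i)) (rmaj r (insertMax σ i))
        = ∑ c ∈ range (range (n + 1) \ S).card, f (rdes r σ + 1) (rmaj r σ + (S.card + c)) := by
      rw [← sum_rank_lt _ fun c => f (rdes r σ + 1) (rmaj r σ + (S.card + c))]
      refine sum_congr rfl fun i hi => ?_
      rw [mem_sdiff, mem_range] at hi
      have hin : i ≤ n := by omega
      rw [rdes_insertMax r hr σ hin, rmaj_insertMax r hr σ hin, if_neg hi.2, if_neg hi.2, ← hSdef]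
      congr 1
      -- For a gap i that is not quiet, i counts the gaps before it. Hence i plus the quiet gaps
      -- after it equals |S| plus the non-quiet gaps before it.
      have e1 : (S.filter (· < i)).card + (S.filter (i < ·)).card = S.card := by
        rw [← card_union_of_disjoint]
        · congr 1
          ext j
          simp only [mem_union, mem_filter]
          constructor
          · tauto
          · intro hj
            have : j ≠ i := fun h => hi.2 (h ▸ hj)
            rcases lt_or_gt_of_ne this with h | h <;> tauto
        · rw [disjoint_left]
          intro j h1 h2
          rw [mem_filter] at h1 h2
          omega
      have e2 : (S.filter (· < i)).card + ((range (n + 1) \ S).filter (· < i)).card = i := by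
        rw [← card_union_of_disjoint]
        · rw [← filter_union, union_sdiff_of_subset hsub]
          have : (range (n + 1)).filter (· < i) = range i := by
            ext j
            simp only [mem_filter, mem_range]
            omega
          rw [this, card_range]
        · exact disjoint_filter_filter disjoint_sdiff
      omega
    rw [h1, h2, card_sdiff_of_subset hsub, card_range]
    conv_rhs => rw [show n + 1 = S.card + (n + 1 - S.card) by omega, sum_range_add]
    congr 1
    · refine sum_congr rfl fun c hc => ?_
      rw [if_pos (by rw [← hS]; exact mem_range.mp hc)]
    · refine sum_congr rfl fun c hc => ?_
      rw [if_neg (by omega)]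
  · intro σ s hs σ' s' hs' h
    rw [mem_range] at hs hs'
    exact insertMax_injective (by omega) (by omega) h

/-! ### The initial range n ≤ r for (rdes, rmaj) -/

theorem rdes_eq_zero {r n : ℕ} (hn : n ≤ r) (π : Equiv.Perm (Fin n)) : rdes r π = 0 := by
  rw [rdes_eq, card_eq_zero, eq_empty_iff_forall_notMem]
  intro p hp
  rw [mem_desSet] at hp
  have h1 := mem_Icc.mp (word_mem π (p := p) (mem_Icc.mpr ⟨by omega, by omega⟩))
  have h2 := mem_Icc.mp (word_mem π (p := p + 1) (mem_Icc.mpr ⟨by omega, by omega⟩))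
  omega

/-- Two letters differ by less than n ≤ r, so there are no r-descents and every inversion is an
r-inversion. -/
theorem rmaj_eq_inv {r n : ℕ} (hn : n ≤ r) (π : Equiv.Perm (Fin n)) :
    rmaj r π = invOn (Icc 1 n) (word π) := by
  have h0 := rdes_eq_zero hn π
  rw [rdes_eq, card_eq_zero] at h0
  rw [rmaj_eq, h0, sum_empty, zero_add, invOn]
  refine sum_congr rfl fun a ha => sum_congr rfl fun b hb => if_congr ?_ rfl rfl
  have h1 := mem_Icc.mp (word_mem π ha)
  have h2 := mem_Icc.mp (word_mem π hb)
  omega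

/-! ### Excedance places and admissible words of the remaining letters -/

/-- The excedance places with gap `g` and level `m` of the word `w` of length `n`. -/
def excSet (g m n : ℕ) (w : ℕ → ℕ) : Finset ℕ :=
  (Icc 1 n).filter fun p => p + g ≤ w p ∧ m ≤ w p

theorem mem_excSet {g m n : ℕ} {w : ℕ → ℕ} {p : ℕ} :
    p ∈ excSet g m n w ↔ p ∈ Icc 1 n ∧ p + g ≤ w p ∧ m ≤ w p := mem_filter

/-- The places in `[n]` outside `I`, in increasing order. -/
def restPlaces (I : Finset ℕ) (n : ℕ) : List ℕ := (List.range' 1 n).filter (· ∉ I)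

/-- The subword of `w` formed by the letters at the places in `[n]` outside `I`. -/
def restWord (I : Finset ℕ) (n : ℕ) (w : ℕ → ℕ) : List ℕ := (restPlaces I n).map w

theorem pairwise_restPlaces (I : Finset ℕ) (n : ℕ) : (restPlaces I n).Pairwise (· < ·) :=
  (List.pairwise_lt_range' (s := 1) (n := n) (step := 1) (by omega)).filter _

theorem nodup_restPlaces (I : Finset ℕ) (n : ℕ) : (restPlaces I n).Nodup :=
  (pairwise_restPlaces I n).imp fun h => h.ne

theorem mem_restPlaces {I : Finset ℕ} {n p : ℕ} : p ∈ restPlaces I n ↔ p ∈ Icc 1 n \ I := by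
  simp only [restPlaces, List.mem_filter, List.mem_range'_1, decide_eq_true_eq, mem_sdiff, mem_Icc]
  refine and_congr_left' ?_
  omega

theorem toFinset_restPlaces (I : Finset ℕ) (n : ℕ) : (restPlaces I n).toFinset = Icc 1 n \ I := by
  ext p
  rw [List.mem_toFinset, mem_restPlaces]

theorem length_restPlaces {I : Finset ℕ} {n : ℕ} (hI : I ⊆ Icc 1 n) :
    (restPlaces I n).length + I.card = n := by
  rw [← List.toFinset_card_of_nodup (nodup_restPlaces I n), toFinset_restPlaces,
    card_sdiff_add_card_eq_card hI, Nat.card_Icc]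
  rfl

theorem card_filter_lt_getElem (P : List ℕ) (hP : P.Pairwise (· < ·)) (t : ℕ)
    (ht : t < P.length) : (P.toFinset.filter (· < P[t])).card = t := by
  induction P generalizing t with
  | nil => simp at ht
  | cons a P ih =>
    rw [List.pairwise_cons] at hP
    have ha : a ∉ P.toFinset := fun h => lt_irrefl _ (hP.1 a (by simpa using h))
    cases t with
    | zero =>
      rw [card_eq_zero, filter_eq_empty_iff]
      intro b hb
      rw [List.mem_toFinset, List.mem_cons] at hb
      rw [List.getElem_cons_zero, not_lt]
      rcases hb with rfl | hb
      · exact le_rfl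
      · exact (hP.1 b hb).le
    | succ t =>
      have ht' : t < P.length := by simpa using ht
      rw [List.toFinset_cons, List.getElem_cons_succ, filter_insert,
        if_pos (hP.1 _ (List.getElem_mem ht')), card_insert_of_notMem, ih hP.2 t ht']
      exact fun h => ha (mem_filter.mp h).1

theorem card_filter_lt_restPlaces (I : Finset ℕ) (n t : ℕ) (ht : t < (restPlaces I n).length) :
    ((Icc 1 n \ I).filter (· < (restPlaces I n)[t])).card = t := by
  rw [← toFinset_restPlaces]
  exact card_filter_lt_getElem _ (pairwise_restPlaces I n) t ht

/-- The number of places outside `I` at which the letter `y` is a `g`-gap excedance. -/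
def gapCount (g : ℕ) (I : Finset ℕ) (y : ℕ) : ℕ := (Icc 1 (y - g) \ I).card

/-- The words that may stand at the places outside `I` without creating a `g`-gap excedance whose
letter is at least `m`. -/
def Admissible (g m : ℕ) (I : Finset ℕ) (N : List ℕ) : Prop :=
  ∀ (t : ℕ) (h : t < N.length), m ≤ N[t] → gapCount g I N[t] ≤ t

/-- If a letter y ≥ m is no excedance, its place lies beyond y - g. All free places up to y - g then
precede it, and the index in the word counts the free places before it. -/
theorem admissible_restWord {g m n : ℕ} {w : ℕ → ℕ} (hw : ∀ p ∈ Icc 1 n, w p ∈ Icc 1 n) :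
    Admissible g m (excSet g m n w) (restWord (excSet g m n w) n w) := by
  intro t h hm
  have h' : t < (restPlaces (excSet g m n w) n).length := by simpa [restWord] using h
  simp only [restWord, List.getElem_map] at hm ⊢
  have hp := mem_restPlaces.mp (List.getElem_mem h')
  conv_rhs => rw [← card_filter_lt_restPlaces _ n t h']
  set p := (restPlaces (excSet g m n w) n)[t]
  rw [mem_sdiff, mem_excSet] at hp
  have hwp := mem_Icc.mp (hw p hp.1)
  refine card_le_card fun q hq => ?_
  rw [mem_sdiff, mem_Icc] at hq
  rw [mem_filter, mem_sdiff, mem_Icc]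
  have : ¬ (p + g ≤ w p) := fun h => hp.2 ⟨hp.1, h, hm⟩
  exact ⟨⟨by omega, hq.2⟩, by omega⟩

/-- Converse direction: an excedance at a free place p would put p and all free places before it
into [y - g], making the gap count at least t + 1. -/
theorem excSet_eq_of_admissible {g m n : ℕ} {w : ℕ → ℕ} {I : Finset ℕ} (hI : I ⊆ Icc 1 n)
    (hw : ∀ p ∈ Icc 1 n, w p ∈ Icc 1 n)
    (hge : ∀ p ∈ I, p + g ≤ w p ∧ m ≤ w p) (hadm : Admissible g m I (restWord I n w)) :
    excSet g m n w = I := by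
  ext p
  rw [mem_excSet]
  refine ⟨fun ⟨hp, h1, h2⟩ => ?_, fun hp => ⟨hI hp, hge p hp⟩⟩
  by_contra hpI
  obtain ⟨t, ht, rfl⟩ := List.getElem_of_mem (mem_restPlaces.mpr (mem_sdiff.mpr ⟨hp, hpI⟩))
  have h3 := hadm t (by simpa [restWord] using ht)
  simp only [restWord, List.getElem_map] at h3
  have h4 := h3 h2
  have h5 := card_filter_lt_restPlaces I n t ht
  set p := (restPlaces I n)[t]
  have hwp := mem_Icc.mp (hw p hp)
  rw [mem_Icc] at hp
  have : insert p ((Icc 1 n \ I).filter (· < p)) ⊆ Icc 1 (w p - g) \ I := by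
    intro q hq
    rw [mem_insert, mem_filter, mem_sdiff, mem_Icc] at hq
    rw [mem_sdiff, mem_Icc]
    rcases hq with rfl | hq
    · exact ⟨by omega, hpI⟩
    · exact ⟨by omega, hq.1.2⟩
  have := card_le_card this
  rw [card_insert_of_notMem (by simp), h5] at this
  rw [gapCount] at h4
  omega

theorem gapCount_anti {g y : ℕ} {I I' : Finset ℕ} (h : I ⊆ I') :
    gapCount g I' y ≤ gapCount g I y :=
  card_le_card (sdiff_subset_sdiff Subset.rfl h)

theorem gapCount_mono {g y y' : ℕ} (I : Finset ℕ) (h : y ≤ y') :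
    gapCount g I y ≤ gapCount g I y' :=
  card_le_card (sdiff_subset_sdiff (Icc_subset_Icc_right (by omega)) Subset.rfl)

theorem gapCount_insert {g y i : ℕ} {I : Finset ℕ} (hi : i ∉ I) (h1 : 1 ≤ i) (h : i + g ≤ y) :
    gapCount g I y = gapCount g (insert i I) y + 1 := by
  rw [gapCount, gapCount, ← card_insert_of_notMem (a := i) (by simp)]
  congr 1
  ext q
  simp only [mem_insert, mem_sdiff, mem_Icc]
  by_cases hq : q = i
  · subst hq
    simp only [hi, true_or, not_false_eq_true, and_true, iff_true]
    omega
  · simp [hq]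

/-- The old letters keep their index or move right, so their bounds survive. -/
theorem Admissible.insertIdx {g m : ℕ} {I : Finset ℕ} {N : List ℕ} (hN : Admissible g m I N)
    {t x : ℕ} (ht : t ≤ N.length) (hx : gapCount g I x ≤ t) :
    Admissible g m I (N.insertIdx t x) := by
  intro s hs hm
  rw [List.getElem_insertIdx] at hm ⊢
  rw [List.length_insertIdx_of_le_length ht] at hs
  split_ifs at hm ⊢ with h1 h2
  · exact hN s (by omega) hm
  · omega
  · exact (hN (s - 1) (by omega) hm).trans (by omega)

/-- The inserted letter meets its bound with equality, and no letter of level m further right does,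
since those had index one less before the insertion. Thus it is recovered as the last tight letter.
-/
theorem Admissible.gapCount_insertIdx_inj {g m : ℕ} {I : Finset ℕ} {N N' : List ℕ}
    (hN : Admissible g m I N) (hN' : Admissible g m I N') {x x' : ℕ} (hx : m ≤ x) (hx' : m ≤ x')
    (hl : gapCount g I x ≤ N.length) (hl' : gapCount g I x' ≤ N'.length)
    (h : N.insertIdx (gapCount g I x) x = N'.insertIdx (gapCount g I x') x') :
    x = x' ∧ N = N' := by
  have aux : ∀ {N N' : List ℕ} {x x' : ℕ}, Admissible g m I N → m ≤ x' →
      gapCount g I x ≤ N.length → gapCount g I x' ≤ N'.length →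
      N.insertIdx (gapCount g I x) x = N'.insertIdx (gapCount g I x') x' →
      ¬ gapCount g I x < gapCount g I x' := by
    intro N N' x x' hN hx' hl hl' h hlt
    have hlen := congrArg List.length h
    rw [List.length_insertIdx_of_le_length hl, List.length_insertIdx_of_le_length hl'] at hlen
    have e1 : (N'.insertIdx (gapCount g I x') x')[gapCount g I x']'(by
        rw [List.length_insertIdx_of_le_length hl']; omega) = x' := by
      rw [List.getElem_insertIdx_self]
    simp only [← h] at e1
    rw [List.getElem_insertIdx_of_gt hlt] at e1
    have := hN (gapCount g I x' - 1) (by omega) (by omega)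
    rw [e1] at this
    omega
  have hk : gapCount g I x = gapCount g I x' :=
    le_antisymm (not_lt.mp (aux hN' hx hl' hl h.symm)) (not_lt.mp (aux hN hx' hl hl' h))
  have e1 : (N.insertIdx (gapCount g I x) x)[gapCount g I x]? = some x := by
    rw [List.getElem?_insertIdx_self, if_pos hl]
  have e2 : (N'.insertIdx (gapCount g I x') x')[gapCount g I x']? = some x' := by
    rw [List.getElem?_insertIdx_self, if_pos hl']
  rw [h, hk, e2] at e1
  have hxx : x = x' := (Option.some.inj e1).symm
  subst hxx
  refine ⟨rfl, ?_⟩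
  have := congrArg (List.eraseIdx · (gapCount g I x)) h
  simpa only [List.eraseIdx_insertIdx_self] using this

theorem mem_restWord {I : Finset ℕ} {n : ℕ} (hI : I ⊆ Icc 1 n) (π : Equiv.Perm (Fin n)) {y : ℕ} :
    y ∈ restWord I n (word π) ↔ y ∈ Icc 1 n \ I.image (word π) := by
  rw [restWord, List.mem_map, mem_sdiff, mem_image]
  constructor
  · rintro ⟨p, hp, rfl⟩
    rw [mem_restPlaces, mem_sdiff] at hp
    refine ⟨word_mem π hp.1, ?_⟩
    rintro ⟨q, hq, hqp⟩
    exact hp.2 (word_inj π (hI hq) hp.1 hqp ▸ hq)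
  · rintro ⟨hy, hyI⟩
    rw [← image_word π, mem_image] at hy
    obtain ⟨p, hp, rfl⟩ := hy
    exact ⟨p, mem_restPlaces.mpr (mem_sdiff.mpr ⟨hp, fun h => hyI ⟨p, h, rfl⟩⟩), rfl⟩

theorem nodup_restWord (I : Finset ℕ) {n : ℕ} (π : Equiv.Perm (Fin n)) :
    (restWord I n (word π)).Nodup := by
  refine List.Nodup.map_on (fun p hp q hq h => ?_) (nodup_restPlaces I n)
  rw [mem_restPlaces, mem_sdiff] at hp hq
  exact word_inj π hp.1 hq.1 h

theorem length_restWord {I : Finset ℕ} {n : ℕ} (hI : I ⊆ Icc 1 n) (w : ℕ → ℕ) :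
    (restWord I n w).length + I.card = n := by
  rw [restWord, List.length_map, length_restPlaces hI]

theorem listInv_restWord (I : Finset ℕ) (n : ℕ) (w : ℕ → ℕ) :
    listInv (restWord I n w) = invOn (Icc 1 n \ I) w := by
  rw [restWord, ← invOn_toFinset _ (pairwise_restPlaces I n), toFinset_restPlaces]

/-- `π` has the excedance places `I`, the letters `e` at these places, and the subword `N` of the
remaining letters. -/
def HasParts (g m : ℕ) {n : ℕ} (I : Finset ℕ) (e : ℕ → ℕ) (N : List ℕ)
    (π : Equiv.Perm (Fin n)) : Prop :=
  excSet g m n (word π) = I ∧ (∀ p ∈ I, word π p = e p) ∧ restWord I n (word π) = N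

theorem HasParts.eq {g m n : ℕ} {I : Finset ℕ} {e e' : ℕ → ℕ} {N : List ℕ}
    {π π' : Equiv.Perm (Fin n)} (h : HasParts g m I e N π) (h' : HasParts g m I e' N π')
    (he : ∀ p ∈ I, e p = e' p) : π = π' := by
  refine word_ext fun p hp => ?_
  by_cases hpI : p ∈ I
  · rw [h.2.1 p hpI, h'.2.1 p hpI, he p hpI]
  · exact List.map_inj_left.mp (h.2.2.trans h'.2.2.symm) p
      (mem_restPlaces.mpr (mem_sdiff.mpr ⟨hp, hpI⟩))

theorem exists_hasParts {g m n : ℕ} {I : Finset ℕ} {e : ℕ → ℕ} {N : List ℕ} (hI : I ⊆ Icc 1 n)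
    (he : ∀ p ∈ I, e p ∈ Icc 1 n) (hge : ∀ p ∈ I, p + g ≤ e p ∧ m ≤ e p)
    (hinj : ∀ p ∈ I, ∀ q ∈ I, e p = e q → p = q) (hN : ∀ y ∈ N, y ∈ Icc 1 n) (hnd : N.Nodup)
    (hdis : ∀ p ∈ I, e p ∉ N) (hlen : N.length + I.card = n) (hadm : Admissible g m I N) :
    ∃ π : Equiv.Perm (Fin n), HasParts g m I e N π := by
  set P := restPlaces I n with hP
  have hPl : P.length + I.card = n := length_restPlaces hI
  -- The t-th free place receives the t-th letter of `N`; the default 0 is never reached on `P`.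
  set f : ℕ → ℕ := fun p => N.getD (P.idxOf p) 0 with hf
  have hPf : P.map f = N := by
    apply List.ext_getElem
    · rw [List.length_map]
      omega
    · intro t h1 h2
      rw [List.length_map] at h1
      rw [List.getElem_map]
      change N.getD (P.idxOf P[t]) 0 = N[t]
      rw [(nodup_restPlaces I n).idxOf_getElem t h1, List.getD_eq_getElem _ _ h2]
  have hmem : ∀ p ∈ Icc 1 n, p ∉ I → p ∈ P := fun p hp hpI =>
    mem_restPlaces.mpr (mem_sdiff.mpr ⟨hp, hpI⟩)
  have hfN : ∀ p ∈ P, f p ∈ N := fun p hp => hPf ▸ List.mem_map_of_mem hp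
  obtain ⟨π, hπ⟩ := exists_word (n := n) (fun p => if p ∈ I then e p else f p) (by
      intro p hp
      by_cases hpI : p ∈ I
      · rw [if_pos hpI]
        exact he p hpI
      · rw [if_neg hpI]
        exact hN _ (hfN p (hmem p hp hpI))) (by
      intro p hp q hq h
      by_cases h1 : p ∈ I <;> by_cases h2 : q ∈ I
      · rw [if_pos h1, if_pos h2] at h
        exact hinj p h1 q h2 h
      · rw [if_pos h1, if_neg h2] at h
        exact absurd (h ▸ hfN q (hmem q hq h2)) (hdis p h1)
      · rw [if_neg h1, if_pos h2] at h
        exact absurd (h ▸ hfN p (hmem p hp h1)) (hdis q h2)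
      · rw [if_neg h1, if_neg h2] at h
        exact List.inj_on_of_nodup_map (hPf ▸ hnd) (hmem p hp h1) (hmem q hq h2) h)
  have hπe : ∀ p ∈ I, word π p = e p := fun p hp => by rw [hπ p (hI hp), if_pos hp]
  have hπN : restWord I n (word π) = N := by
    rw [← hPf, restWord]
    refine List.map_inj_left.mpr fun p hp => ?_
    rw [mem_restPlaces, mem_sdiff] at hp
    rw [hπ p hp.1, if_neg hp.2]
  refine ⟨π, ?_, hπe, hπN⟩
  refine excSet_eq_of_admissible hI (fun p hp => word_mem π hp) (fun p hp => ?_) (hπN ▸ hadm)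
  rw [hπe p hp]
  exact hge p hp

/-- The restriction to the places below n is automatic, since g ≥ 1 forces place < letter ≤ n. -/
theorem image_place_gExcp {g : ℕ} (hg : 1 ≤ g) (m : ℕ) {n : ℕ} (π : Equiv.Perm (Fin n)) :
    (gExcp g m π).image place = excSet g m n (word π) := by
  ext p
  simp only [mem_image, gExcp, mem_filter, mem_univ, true_and, mem_excSet]
  constructor
  · rintro ⟨i, ⟨-, h1, h2⟩, rfl⟩
    rw [word_place]
    exact ⟨place_mem i, h1, h2⟩
  · rintro ⟨h, h1, h2⟩
    have := mem_Icc.mp (word_mem π h)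
    obtain ⟨i, rfl⟩ := exists_place h
    rw [word_place] at h1 h2 this
    exact ⟨i, ⟨by omega, h1, h2⟩, rfl⟩

theorem gden_eq {g : ℕ} (hg : 1 ≤ g) (m : ℕ) {n : ℕ} (π : Equiv.Perm (Fin n)) :
    gden g m π = ∑ p ∈ excSet g m n (word π), (p + g - 1) + invOn (excSet g m n (word π)) (word π)
      + listInv (restWord (excSet g m n (word π)) n (word π)) := by
  have h : (gNexcp g m π).image place = Icc 1 n \ excSet g m n (word π) := by
    rw [← image_place_gExcp hg, ← image_place_univ, ← image_sdiff_of_injOn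
      place_injective.injOn (subset_univ _), gNexcp, compl_eq_univ_sdiff]
  rw [gden, subwordInv_eq, subwordInv_eq, h, listInv_restWord, image_place_gExcp hg,
    sum_image_place _ fun p => p + g - 1, image_place_gExcp hg]

/-- A gap-g excedance at a place ≥ l has a letter ≥ g + l, so the level on places can be read off
from the excedance set with level g + l on letters. -/
theorem gexc_eq (g l : ℕ) {n : ℕ} (π : Equiv.Perm (Fin n)) :
    gexc g l π = ((excSet g (g + l) n (word π)).filter (l ≤ ·)).card := by
  rw [gexc, ← card_image_place]
  congr 1
  ext p
  simp only [mem_image, mem_filter, mem_univ, true_and, mem_excSet]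
  constructor
  · rintro ⟨i, ⟨h1, h2⟩, rfl⟩
    rw [word_place]
    exact ⟨⟨place_mem i, h1, by omega⟩, h2⟩
  · rintro ⟨⟨h, h1, -⟩, h2⟩
    obtain ⟨i, rfl⟩ := exists_place h
    rw [word_place] at h1
    exact ⟨i, ⟨h1, h2⟩, rfl⟩

theorem HasParts.gden_eq {g m n : ℕ} {I : Finset ℕ} {e : ℕ → ℕ} {N : List ℕ}
    {π : Equiv.Perm (Fin n)} (h : HasParts g m I e N π) (hg : 1 ≤ g) :
    gden g m π = ∑ p ∈ I, (p + g - 1) + invOn I e + listInv N := by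
  rw [PermStat.gden_eq hg, h.1, h.2.2, invOn_congr h.2.1]

theorem HasParts.gexc_eq {g l n : ℕ} {I : Finset ℕ} {e : ℕ → ℕ} {N : List ℕ}
    {π : Equiv.Perm (Fin n)} (h : HasParts g (g + l) I e N π) :
    gexc g l π = (I.filter (l ≤ ·)).card := by
  rw [PermStat.gexc_eq, h.1]

/-! ### Exchanging one letter for a greater one in order-preserving fashion -/

/-- The order isomorphism of `A` onto `A` with `x` replaced by the greater number `M`. -/
noncomputable def bump (A : Finset ℕ) (M x y : ℕ) : ℕ :=
  if y < x then y else sInf {z | y < z ∧ (z ∈ A ∨ z = M)}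

theorem bump_spec {A : Finset ℕ} {M x y : ℕ} (hxy : x ≤ y) (hy : y < M) :
    y < bump A M x y ∧ (bump A M x y ∈ A ∨ bump A M x y = M) := by
  rw [bump, if_neg hxy.not_gt]
  exact Nat.sInf_mem (s := {z | y < z ∧ (z ∈ A ∨ z = M)}) ⟨M, hy, Or.inr rfl⟩

theorem bump_le {A : Finset ℕ} {M x y z : ℕ} (hxy : x ≤ y) (hyz : y < z) (hz : z ∈ A) :
    bump A M x y ≤ z := by
  rw [bump, if_neg hxy.not_gt]
  exact Nat.sInf_le ⟨hyz, Or.inl hz⟩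

theorem le_bump {A : Finset ℕ} {M x y : ℕ} (hy : y < M) : y ≤ bump A M x y := by
  rcases lt_or_ge y x with h | h
  · rw [bump, if_pos h]
  · exact (bump_spec h hy).1.le

theorem bump_lt_bump {A : Finset ℕ} {M x y z : ℕ} (hA : ∀ a ∈ A, a < M) (hz : z ∈ A)
    (hyz : y < z) : bump A M x y < bump A M x z := by
  rcases lt_or_ge y x with h | h
  · rw [bump, if_pos h]
    exact hyz.trans_le (le_bump (hA z hz))
  · exact (bump_le h hyz hz).trans_lt (bump_spec (h.trans hyz.le) (hA z hz)).1

theorem bump_lt_bump_iff {A : Finset ℕ} {M x y z : ℕ} (hA : ∀ a ∈ A, a < M) (hy : y ∈ A)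
    (hz : z ∈ A) : bump A M x y < bump A M x z ↔ y < z := by
  refine ⟨fun h => ?_, bump_lt_bump hA hz⟩
  by_contra hn
  rcases (not_lt.mp hn).lt_or_eq with h' | rfl
  · exact lt_asymm h (bump_lt_bump hA hy h')
  · exact lt_irrefl _ h

theorem bump_inj {A : Finset ℕ} {M x y z : ℕ} (hA : ∀ a ∈ A, a < M) (hy : y ∈ A) (hz : z ∈ A)
    (h : bump A M x y = bump A M x z) : y = z := by
  rcases lt_trichotomy y z with h' | h' | h'
  · exact absurd h (bump_lt_bump hA hz h').ne
  · exact h'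
  · exact absurd h (bump_lt_bump hA hy h').ne'

theorem image_bump {A : Finset ℕ} {M x : ℕ} (hA : ∀ a ∈ A, a < M) (hx : x ∈ A) :
    A.image (bump A M x) = insert M (A.erase x) := by
  have hM : M ∉ A.erase x := fun h => lt_irrefl _ (hA M (mem_of_mem_erase h))
  apply eq_of_subset_of_card_le
  · intro z hz
    obtain ⟨y, hy, rfl⟩ := mem_image.mp hz
    rw [mem_insert, mem_erase]
    rcases lt_or_ge y x with h | h
    · rw [bump, if_pos h]
      exact Or.inr ⟨h.ne, hy⟩
    · obtain ⟨h1, h2 | h2⟩ := bump_spec (A := A) h (hA y hy)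
      · exact Or.inr ⟨by omega, h2⟩
      · exact Or.inl h2
  · rw [card_insert_of_notMem hM, card_erase_add_one hx,
      card_image_of_injOn fun y hy z hz h => bump_inj hA hy hz h]

theorem countP_eq_card {N : List ℕ} (hN : N.Nodup) (x : ℕ) :
    N.countP (· < x) = (N.toFinset.filter (· < x)).card := by
  rw [List.countP_eq_length_filter, ← List.toFinset_card_of_nodup (hN.filter _)]
  congr 1
  ext y
  simp

theorem excSet_subset (g m n : ℕ) (w : ℕ → ℕ) : excSet g m n w ⊆ Icc 1 n := filter_subset _ _

theorem nodup_insertIdx {N : List ℕ} (hN : N.Nodup) {t x : ℕ} (ht : t ≤ N.length) (hx : x ∉ N) :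
    (N.insertIdx t x).Nodup := by
  rw [(List.perm_insertIdx x N ht).nodup_iff, List.nodup_cons]
  exact ⟨hx, hN⟩

theorem mem_insertIdx_iff {N : List ℕ} {t x y : ℕ} (ht : t ≤ N.length) :
    y ∈ N.insertIdx t x ↔ y = x ∨ y ∈ N := by
  rw [(List.perm_insertIdx x N ht).mem_iff, List.mem_cons]

/-! ### The three insertions and their effect on gden -/

/-- The letters of `w` at the places of `I` at which `x` is a `g`-gap excedance letter. -/
def lowLetters (g : ℕ) (I : Finset ℕ) (w : ℕ → ℕ) (x : ℕ) : Finset ℕ :=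
  (I.filter (· + g ≤ x)).image w

/-- The letters `w` on `I`, where the letter `x` is removed and `M` is added, with the relative
order of the letters at the places `p ≤ x - g` preserved. -/
noncomputable def bumpWord (g : ℕ) (I : Finset ℕ) (w : ℕ → ℕ) (M x p : ℕ) : ℕ :=
  if p + g ≤ x then bump (lowLetters g I w x) M x (w p) else w p

section Insertion

variable {g m n : ℕ} (σ : Equiv.Perm (Fin n))

theorem gapCount_le_length (x : ℕ) (hx : x ≤ n) :
    gapCount g (excSet g m n (word σ)) x
      ≤ (restWord (excSet g m n (word σ)) n (word σ)).length := by
  have h1 := length_restWord (excSet_subset g m n (word σ)) (word σ)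
  have h2 := card_sdiff_add_card_eq_card (excSet_subset g m n (word σ))
  rw [Nat.card_Icc] at h2
  have h3 : gapCount g (excSet g m n (word σ)) x ≤ (Icc 1 n \ excSet g m n (word σ)).card :=
    card_le_card (sdiff_subset_sdiff (Icc_subset_Icc_right (by omega)) Subset.rfl)
  omega

theorem excSet_subset_Icc_sub : excSet g m n (word σ) ⊆ Icc 1 (n - g) := by
  intro p hp
  rw [mem_excSet] at hp
  have := mem_Icc.mp (word_mem σ hp.1)
  rw [mem_Icc] at *
  omega

theorem exists_hasParts_rest (hgn : g ≤ n) {c : ℕ} (hc : c < g) :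
    ∃ π : Equiv.Perm (Fin (n + 1)), HasParts g m (excSet g m n (word σ)) (word σ)
      ((restWord (excSet g m n (word σ)) n (word σ)).insertIdx
        ((restWord (excSet g m n (word σ)) n (word σ)).length - c) (n + 1)) π := by
  set I := excSet g m n (word σ) with hI
  set N := restWord I n (word σ) with hN
  have hIs : I ⊆ Icc 1 n := excSet_subset _ _ _ _
  have hlen : N.length + I.card = n := length_restWord hIs _
  have hmem : ∀ {y}, y ∈ N ↔ y ∈ Icc 1 n \ I.image (word σ) := mem_restWord hIs σ
  have hM : n + 1 ∉ N := fun h => by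
    have := (mem_sdiff.mp (hmem.mp h)).1
    rw [mem_Icc] at this
    omega
  have ht : N.length - c ≤ N.length := by omega
  refine exists_hasParts (hIs.trans (Icc_subset_Icc_right (by omega))) ?_ ?_ ?_ ?_
    (nodup_insertIdx (nodup_restWord I σ) ht hM) ?_ ?_ ?_
  · exact fun p hp => Icc_subset_Icc_right (by omega) (word_mem σ (hIs hp))
  · exact fun p hp => (mem_excSet.mp hp).2
  · exact fun p hp q hq => word_inj σ (hIs hp) (hIs hq)
  · intro y hy
    rw [mem_insertIdx_iff ht] at hy
    rcases hy with rfl | hy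
    · rw [mem_Icc]
      omega
    · exact Icc_subset_Icc_right (by omega) (mem_sdiff.mp (hmem.mp hy)).1
  · intro p hp h
    rw [mem_insertIdx_iff ht] at h
    rcases h with h | h
    · have := mem_Icc.mp (word_mem σ (hIs hp))
      omega
    · exact (mem_sdiff.mp (hmem.mp h)).2 (mem_image_of_mem _ hp)
  · rw [List.length_insertIdx_of_le_length ht]
    omega
  · have hadm : Admissible g m I N := admissible_restWord fun p hp => word_mem σ hp
    refine hadm.insertIdx ht ?_
    -- The gap count of n + 1 is n + 1 - g - |I|, that is |N| + 1 - g, which is at most |N| - c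
    -- because c < g.
    have h1 := card_sdiff_add_card_eq_card
      ((excSet_subset_Icc_sub (g := g) (m := m) σ).trans (Icc_subset_Icc_right
        (show n - g ≤ n + 1 - g by omega)))
    rw [Nat.card_Icc, ← hI] at h1
    rw [gapCount]
    omega

theorem exists_hasParts_new (hm : m ≤ n + 1) (hgn : g ≤ n) {i : ℕ}
    (hi : i ∈ Icc 1 (n + 1 - g) \ excSet g m n (word σ)) :
    ∃ π : Equiv.Perm (Fin (n + 1)), HasParts g m (insert i (excSet g m n (word σ)))
      (Function.update (word σ) i (n + 1)) (restWord (excSet g m n (word σ)) n (word σ)) π := by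
  set I := excSet g m n (word σ) with hI
  set N := restWord I n (word σ) with hN
  have hIs : I ⊆ Icc 1 n := excSet_subset _ _ _ _
  have hlen : N.length + I.card = n := length_restWord hIs _
  have hmem : ∀ {y}, y ∈ N ↔ y ∈ Icc 1 n \ I.image (word σ) := mem_restWord hIs σ
  rw [mem_sdiff, mem_Icc] at hi
  have hne : ∀ p ∈ I, p ≠ i := fun p hp h => hi.2 (h ▸ hp)
  have hup : ∀ p ∈ I, Function.update (word σ) i (n + 1) p = word σ p := fun p hp =>
    Function.update_of_ne (hne p hp) _ _
  have hle : ∀ p ∈ I, 1 ≤ word σ p ∧ word σ p ≤ n := fun p hp => mem_Icc.mp (word_mem σ (hIs hp))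
  refine exists_hasParts ?_ ?_ ?_ ?_ ?_ (nodup_restWord I σ) ?_ ?_ ?_
  · refine insert_subset (mem_Icc.mpr (by omega)) (hIs.trans (Icc_subset_Icc_right (by omega)))
  · intro p hp
    rcases mem_insert.mp hp with rfl | hp
    · rw [Function.update_self, mem_Icc]
      omega
    · rw [hup p hp, mem_Icc]
      have := hle p hp
      omega
  · intro p hp
    rcases mem_insert.mp hp with rfl | hp
    · rw [Function.update_self]
      omega
    · rw [hup p hp]
      exact (mem_excSet.mp hp).2
  · intro p hp q hq h
    rcases mem_insert.mp hp with h1 | h1 <;> rcases mem_insert.mp hq with h2 | h2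
    · rw [h1, h2]
    · rw [h1, Function.update_self, hup q h2] at h
      have := hle q h2
      omega
    · rw [h2, Function.update_self, hup p h1] at h
      have := hle p h1
      omega
    · rw [hup p h1, hup q h2] at h
      exact word_inj σ (hIs h1) (hIs h2) h
  · exact fun y hy => Icc_subset_Icc_right (by omega) (mem_sdiff.mp (hmem.mp hy)).1
  · intro p hp h
    have h' := mem_sdiff.mp (hmem.mp h)
    rcases mem_insert.mp hp with rfl | hp
    · rw [Function.update_self, mem_Icc] at h'
      omega
    · rw [hup p hp] at h'
      exact h'.2 (mem_image_of_mem _ hp)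
  · rw [card_insert_of_notMem hi.2]
    omega
  -- Enlarging the set of excedance places only lowers gap counts.
  · exact fun t h hm => (gapCount_anti (subset_insert i I)).trans
      (admissible_restWord (fun p hp => word_mem σ hp) t h hm)

theorem mem_lowLetters_of_mem_image {x : ℕ}
    (hx : x ∈ (excSet g m n (word σ)).image (word σ)) :
    x ∈ lowLetters g (excSet g m n (word σ)) (word σ) x := by
  obtain ⟨p, hp, rfl⟩ := mem_image.mp hx
  exact mem_image_of_mem _ (mem_filter.mpr ⟨hp, (mem_excSet.mp hp).2.1⟩)

theorem lt_of_mem_lowLetters {x : ℕ} :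
    ∀ a ∈ lowLetters g (excSet g m n (word σ)) (word σ) x, a < n + 1 := by
  intro a ha
  obtain ⟨p, hp, rfl⟩ := mem_image.mp ha
  have := mem_Icc.mp (word_mem σ (excSet_subset _ _ _ _ (mem_filter.mp hp).1))
  omega

theorem bumpWord_low {x p : ℕ} (hx : x ∈ (excSet g m n (word σ)).image (word σ))
    (hp : p ∈ excSet g m n (word σ)) (hpx : p + g ≤ x) :
    bumpWord g (excSet g m n (word σ)) (word σ) (n + 1) x p ∈
      insert (n + 1) ((lowLetters g (excSet g m n (word σ)) (word σ) x).erase x) := by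
  rw [bumpWord, if_pos hpx, ← image_bump (lt_of_mem_lowLetters σ) (mem_lowLetters_of_mem_image σ hx)]
  exact mem_image_of_mem _ (mem_image_of_mem _ (mem_filter.mpr ⟨hp, hpx⟩))

/-- On each side of the threshold x - g the letters stay distinct. Across it, a low place receives n
+ 1 or another low letter, never the unchanged letter of a high place. -/
theorem bumpWord_inj {x p q : ℕ} (hx : x ∈ (excSet g m n (word σ)).image (word σ))
    (hp : p ∈ excSet g m n (word σ)) (hq : q ∈ excSet g m n (word σ))
    (h : bumpWord g (excSet g m n (word σ)) (word σ) (n + 1) x p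
      = bumpWord g (excSet g m n (word σ)) (word σ) (n + 1) x q) : p = q := by
  have hIs := excSet_subset g m n (word σ)
  have aux : ∀ {p q}, p ∈ excSet g m n (word σ) → q ∈ excSet g m n (word σ) → p + g ≤ x →
      ¬ q + g ≤ x → bumpWord g (excSet g m n (word σ)) (word σ) (n + 1) x p
        ≠ bumpWord g (excSet g m n (word σ)) (word σ) (n + 1) x q := by
    intro p q hp hq h1 h2 h
    have h3 := bumpWord_low σ hx hp h1
    rw [h, bumpWord, if_neg h2, mem_insert, mem_erase] at h3
    have := mem_Icc.mp (word_mem σ (hIs hq))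
    rcases h3 with h3 | ⟨-, h3⟩
    · omega
    · obtain ⟨r, hr, hrq⟩ := mem_image.mp h3
      rw [mem_filter] at hr
      rw [word_inj σ (hIs hr.1) (hIs hq) hrq] at hr
      exact h2 hr.2
  by_cases h1 : p + g ≤ x <;> by_cases h2 : q + g ≤ x
  · rw [bumpWord, bumpWord, if_pos h1, if_pos h2] at h
    exact word_inj σ (hIs hp) (hIs hq) (bump_inj (lt_of_mem_lowLetters σ)
      (mem_image_of_mem _ (mem_filter.mpr ⟨hp, h1⟩))
      (mem_image_of_mem _ (mem_filter.mpr ⟨hq, h2⟩)) h)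
  · exact absurd h (aux hp hq h1 h2)
  · exact absurd h.symm (aux hq hp h2 h1)
  · rw [bumpWord, bumpWord, if_neg h1, if_neg h2] at h
    exact word_inj σ (hIs hp) (hIs hq) h

theorem bumpWord_mem {x p : ℕ} (hx : x ∈ (excSet g m n (word σ)).image (word σ))
    (hp : p ∈ excSet g m n (word σ)) :
    bumpWord g (excSet g m n (word σ)) (word σ) (n + 1) x p ∈
      insert (n + 1) (((excSet g m n (word σ)).image (word σ)).erase x) := by
  by_cases h : p + g ≤ x
  · exact insert_subset_insert _ (erase_subset_erase _ (image_subset_image (filter_subset _ _)))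
      (bumpWord_low σ hx hp h)
  · rw [bumpWord, if_neg h, mem_insert, mem_erase]
    have := (mem_excSet.mp hp).2.1
    exact Or.inr ⟨by omega, mem_image_of_mem _ hp⟩

theorem exists_hasParts_bump {x : ℕ}
    (hx : x ∈ (excSet g m n (word σ)).image (word σ)) :
    ∃ π : Equiv.Perm (Fin (n + 1)), HasParts g m (excSet g m n (word σ))
      (bumpWord g (excSet g m n (word σ)) (word σ) (n + 1) x)
      ((restWord (excSet g m n (word σ)) n (word σ)).insertIdx
        (gapCount g (excSet g m n (word σ)) x) x) π := by
  have hbm := fun p hp => bumpWord_mem (p := p) σ hx hp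
  have hbi := fun p q => bumpWord_inj (p := p) (q := q) σ hx
  have hxI := hx
  set I := excSet g m n (word σ) with hI
  set N := restWord I n (word σ) with hN
  have hIs : I ⊆ Icc 1 n := excSet_subset _ _ _ _
  have hJs : I.image (word σ) ⊆ Icc 1 n := by
    rw [← image_word σ]
    exact image_subset_image hIs
  have hxn := mem_Icc.mp (hJs hx)
  have hlen : N.length + I.card = n := length_restWord hIs _
  have hmem : ∀ {y}, y ∈ N ↔ y ∈ Icc 1 n \ I.image (word σ) := mem_restWord hIs σ
  have ht : gapCount g I x ≤ N.length := gapCount_le_length σ x hxn.2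
  have hxN : x ∉ N := fun h => (mem_sdiff.mp (hmem.mp h)).2 hx
  refine exists_hasParts (hIs.trans (Icc_subset_Icc_right (by omega))) ?_ ?_ ?_ ?_
    (nodup_insertIdx (nodup_restWord I σ) ht hxN) ?_ ?_ ?_
  · intro p hp
    have := hbm p hp
    rw [mem_insert, mem_erase] at this
    rcases this with h | h
    · rw [h, mem_Icc]
      omega
    · exact Icc_subset_Icc_right (by omega) (hJs h.2)
  · intro p hp
    have h1 := (mem_excSet.mp hp).2
    have h2 := mem_Icc.mp (word_mem σ (hIs hp))
    have : word σ p ≤ bumpWord g I (word σ) (n + 1) x p := by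
      rw [bumpWord]
      split_ifs
      · exact le_bump (by omega)
      · exact le_rfl
    omega
  · exact fun p hp q hq => hbi p q hp hq
  · intro y hy
    rw [mem_insertIdx_iff ht] at hy
    rcases hy with rfl | hy
    · rw [mem_Icc]
      omega
    · exact Icc_subset_Icc_right (by omega) (mem_sdiff.mp (hmem.mp hy)).1
  · intro p hp h
    rw [mem_insertIdx_iff ht] at h
    have h1 := hbm p hp
    rw [mem_insert, mem_erase] at h1
    rcases h with h | h
    · rw [h] at h1
      rcases h1 with h1 | h1
      · omega
      · exact h1.1 rfl
    · have h2 := mem_sdiff.mp (hmem.mp h)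
      rcases h1 with h1 | h1
      · rw [h1, mem_Icc] at h2
        omega
      · exact h2.2 h1.2
  · rw [List.length_insertIdx_of_le_length ht]
    omega
  · exact Admissible.insertIdx (admissible_restWord fun p hp => word_mem σ hp) ht le_rfl

theorem gden_of_hasParts_rest (hg : 1 ≤ g) (hgn : g ≤ n) {c : ℕ} (hc : c < g)
    {π : Equiv.Perm (Fin (n + 1))} (h : HasParts g m (excSet g m n (word σ)) (word σ)
      ((restWord (excSet g m n (word σ)) n (word σ)).insertIdx
        ((restWord (excSet g m n (word σ)) n (word σ)).length - c) (n + 1)) π) :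
    gden g m π = gden g m σ + c := by
  rw [h.gden_eq hg, gden_eq hg]
  set I := excSet g m n (word σ) with hI
  set N := restWord I n (word σ) with hN
  have hIs : I ⊆ Icc 1 n := excSet_subset _ _ _ _
  have hlen : N.length + I.card = n := length_restWord hIs _
  have hcard := card_le_card (excSet_subset_Icc_sub (g := g) (m := m) σ)
  rw [Nat.card_Icc, ← hI] at hcard
  have hle : ∀ y ∈ N, y ≤ n := fun y hy =>
    (mem_Icc.mp (mem_sdiff.mp ((mem_restWord hIs σ).mp hy)).1).2
  rw [listInv_insertIdx _ _ _ (by omega)]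
  have h1 : (N.take (N.length - c)).countP (n + 1 < ·) = 0 := by
    rw [List.countP_eq_zero]
    intro y hy
    have := hle y (List.mem_of_mem_take hy)
    simp
    omega
  have h2 : (N.drop (N.length - c)).countP (· < n + 1) = c := by
    rw [List.countP_eq_length.mpr, List.length_drop]
    · omega
    · intro y hy
      have := hle y (List.mem_of_mem_drop hy)
      simp
      omega
  rw [h1, h2]
  omega

theorem gden_of_hasParts_new (hg : 1 ≤ g) {i : ℕ}
    (hi : i ∈ Icc 1 (n + 1 - g) \ excSet g m n (word σ)) {π : Equiv.Perm (Fin (n + 1))}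
    (h : HasParts g m (insert i (excSet g m n (word σ)))
      (Function.update (word σ) i (n + 1)) (restWord (excSet g m n (word σ)) n (word σ)) π) :
    gden g m π = gden g m σ + (g + (excSet g m n (word σ)).card
      + ((Icc 1 (n + 1 - g) \ excSet g m n (word σ)).filter (· < i)).card) := by
  rw [h.gden_eq hg, gden_eq hg]
  set I := excSet g m n (word σ) with hI
  have hIs : I ⊆ Icc 1 n := excSet_subset _ _ _ _
  have hi' := mem_sdiff.mp hi
  rw [mem_Icc] at hi'
  have hup : ∀ p ∈ I, Function.update (word σ) i (n + 1) p = word σ p := fun p hp =>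
    Function.update_of_ne (fun h : p = i => hi'.2 (h ▸ hp)) _ _
  have hle : ∀ p ∈ I, word σ p ≤ n := fun p hp => (mem_Icc.mp (word_mem σ (hIs hp))).2
  rw [sum_insert hi'.2, invOn_insert hi'.2, invOn_congr hup, Function.update_self]
  have h1 : (∑ b ∈ I, if i < b ∧ Function.update (word σ) i (n + 1) b < n + 1 then 1 else 0)
      = (I.filter (i < ·)).card := by
    rw [card_filter]
    refine sum_congr rfl fun b hb => if_congr ?_ rfl rfl
    rw [hup b hb]
    have := hle b hb
    omega
  have h2 : (∑ b ∈ I, if b < i ∧ n + 1 < Function.update (word σ) i (n + 1) b then 1 else 0)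
      = 0 := by
    refine sum_eq_zero fun b hb => if_neg ?_
    rw [hup b hb]
    have := hle b hb
    omega
  rw [h1, h2]
  have h3 : (I.filter (i < ·)).card + (I.filter (· < i)).card = I.card := by
    rw [← card_union_of_disjoint]
    · congr 1
      ext p
      simp only [mem_union, mem_filter]
      constructor
      · tauto
      · intro hp
        have : p ≠ i := fun h => hi'.2 (h ▸ hp)
        rcases lt_or_gt_of_ne this with h | h <;> tauto
    · rw [disjoint_left]
      intro p h1 h2
      rw [mem_filter] at h1 h2
      omega
  -- The contribution i + g - 1 of the new place splits as g plus the i - 1 places before i, each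
  -- excedance or free. The new letter also forms inversions with the excedance letters behind it.
  have h4 : (I.filter (· < i)).card + ((Icc 1 (n + 1 - g) \ I).filter (· < i)).card = i - 1 := by
    rw [← card_union_of_disjoint]
    · have : I.filter (· < i) ∪ (Icc 1 (n + 1 - g) \ I).filter (· < i) = Icc 1 (i - 1) := by
        ext p
        have hp : p ∈ I → 1 ≤ p := fun hp => (mem_Icc.mp (hIs hp)).1
        simp only [mem_union, mem_filter, mem_sdiff, mem_Icc]
        by_cases hpI : p ∈ I
        · have := hp hpI
          simp only [hpI, true_and, not_true_eq_false, and_false, false_and, or_false]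
          omega
        · simp only [hpI, false_and, not_false_eq_true, and_true, false_or]
          omega
      rw [this, Nat.card_Icc]
      omega
    · exact disjoint_filter_filter disjoint_sdiff
  omega

/-- Low places precede high ones, and the order within each group is unchanged. A high place b has
w(b) ≥ b + g > x, so replacing x by n + 1 among the low letters adds exactly one inversion with b.
-/
theorem invOn_bumpWord {x : ℕ} (hx : x ∈ (excSet g m n (word σ)).image (word σ)) :
    invOn (excSet g m n (word σ)) (bumpWord g (excSet g m n (word σ)) (word σ) (n + 1) x)
      = invOn (excSet g m n (word σ)) (word σ)
        + ((excSet g m n (word σ)).filter fun p => ¬ p + g ≤ x).card := by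
  have hA := lt_of_mem_lowLetters (g := g) (m := m) (x := x) σ
  have hxA := mem_lowLetters_of_mem_image σ hx
  have hexc : ∀ p ∈ excSet g m n (word σ), p + g ≤ word σ p := fun p hp => (mem_excSet.mp hp).2.1
  have hIs : excSet g m n (word σ) ⊆ Icc 1 n := excSet_subset _ _ _ _
  set I := excSet g m n (word σ) with hI
  set A := lowLetters g I (word σ) x with hAdef
  set w := word σ
  set w' := bumpWord g I w (n + 1) x with hw'
  have hlow : ∀ p ∈ I.filter (· + g ≤ x), w' p = bump A (n + 1) x (w p) := fun p hp => by
    rw [hw', bumpWord, if_pos (mem_filter.mp hp).2]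
  have hhigh : ∀ p ∈ I.filter (fun p => ¬ p + g ≤ x), w' p = w p := fun p hp => by
    rw [hw', bumpWord, if_neg (mem_filter.mp hp).2]
  have hmemA : ∀ p ∈ I.filter (· + g ≤ x), w p ∈ A := fun p hp => mem_image_of_mem _ hp
  have hsplit := filter_union_filter_not_eq (fun p => p + g ≤ x) I
  have hlt : ∀ a ∈ I.filter (· + g ≤ x), ∀ b ∈ I.filter (fun p => ¬ p + g ≤ x), a < b := by
    intro a ha b hb
    rw [mem_filter] at ha hb
    omega
  rw [← hsplit, invOn_union hlt, invOn_union hlt, invOn_congr hhigh, hsplit]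
  have h1 : invOn (I.filter (· + g ≤ x)) w' = invOn (I.filter (· + g ≤ x)) w := by
    refine sum_congr rfl fun a ha => sum_congr rfl fun b hb => ?_
    rw [hlow a ha, hlow b hb]
    exact if_congr (and_congr_right' (bump_lt_bump_iff hA (hmemA b hb) (hmemA a ha))) rfl rfl
  have h2 : ∀ b ∈ I.filter (fun p => ¬ p + g ≤ x),
      ((I.filter (· + g ≤ x)).filter fun a => w' b < w' a).card
        = ((I.filter (· + g ≤ x)).filter fun a => w b < w a).card + 1 := by
    intro b hb
    rw [hhigh b hb]
    have hb' := mem_filter.mp hb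
    have hxb : x < w b := by
      have := hexc b hb'.1
      omega
    have hbn : 1 ≤ w b ∧ w b ≤ n := mem_Icc.mp (word_mem σ (hIs hb'.1))
    have e1 : ((I.filter (· + g ≤ x)).filter fun a => w b < w' a).card
        = ((insert (n + 1) (A.erase x)).filter (w b < ·)).card := by
      rw [← image_bump hA hxA, hAdef, lowLetters, image_image, filter_image,
        card_image_of_injOn]
      · refine congrArg card (filter_congr fun a ha => ?_)
        rw [hlow a ha]
        rfl
      · intro p hp q hq h
        have hp' := (mem_filter.mp (mem_coe.mp hp)).1
        have hq' := (mem_filter.mp (mem_coe.mp hq)).1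
        exact word_inj σ (hIs (mem_filter.mp hp').1) (hIs (mem_filter.mp hq').1)
          (bump_inj hA (hmemA p hp') (hmemA q hq') h)
    have e2 : ((I.filter (· + g ≤ x)).filter fun a => w b < w a).card
        = (A.filter (w b < ·)).card := by
      rw [hAdef, lowLetters, filter_image, card_image_of_injOn]
      intro p hp q hq h
      have hp' := (mem_filter.mp (mem_coe.mp hp)).1
      have hq' := (mem_filter.mp (mem_coe.mp hq)).1
      exact word_inj σ (hIs (mem_filter.mp hp').1) (hIs (mem_filter.mp hq').1) h
    rw [e1, e2, filter_insert, if_pos (by omega), card_insert_of_notMem, filter_erase,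
      erase_eq_of_notMem]
    · rw [mem_filter]
      omega
    · rw [mem_filter, mem_erase]
      intro h
      exact lt_irrefl _ (hA _ h.1.2)
  rw [h1, sum_congr rfl h2, sum_add_distrib, sum_const, smul_eq_mul, mul_one]
  ring

theorem gden_of_hasParts_bump (hg : 1 ≤ g) {x : ℕ}
    (hx : x ∈ (excSet g m n (word σ)).image (word σ)) {π : Equiv.Perm (Fin (n + 1))}
    (h : HasParts g m (excSet g m n (word σ))
      (bumpWord g (excSet g m n (word σ)) (word σ) (n + 1) x)
      ((restWord (excSet g m n (word σ)) n (word σ)).insertIdx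
        (gapCount g (excSet g m n (word σ)) x) x) π) :
    gden g m π = gden g m σ
      + (g + (((excSet g m n (word σ)).image (word σ)).filter (x < ·)).card) := by
  rw [h.gden_eq hg, gden_eq hg, invOn_bumpWord σ hx]
  have hadm : Admissible g m (excSet g m n (word σ)) _ :=
    admissible_restWord fun p hp => word_mem σ hp
  have hexc : ∀ p ∈ excSet g m n (word σ), p + g ≤ word σ p ∧ m ≤ word σ p :=
    fun p hp => (mem_excSet.mp hp).2
  set I := excSet g m n (word σ) with hI
  set N := restWord I n (word σ) with hN
  set J := I.image (word σ) with hJ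
  have hIs : I ⊆ Icc 1 n := excSet_subset _ _ _ _
  have hJs : J ⊆ Icc 1 n := by
    rw [← image_word σ]
    exact image_subset_image hIs
  have hxn := mem_Icc.mp (hJs hx)
  have hxgm : 1 + g ≤ x ∧ m ≤ x := by
    obtain ⟨p, hp, rfl⟩ := mem_image.mp hx
    have := hexc p hp
    have := mem_Icc.mp (hIs hp)
    omega
  have ht : gapCount g I x ≤ N.length := gapCount_le_length σ x hxn.2
  have hJc : J.card = I.card :=
    card_image_of_injOn fun p hp q hq h => word_inj σ (hIs hp) (hIs hq) h
  rw [listInv_insertIdx _ _ _ ht]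
  -- A letter y ≥ x has level m and a gap count at least that of x, so admissibility keeps it out of
  -- this prefix.
  have htake : ∀ y ∈ N.take (gapCount g I x), y < x := by
    intro y hy
    obtain ⟨t, ht', rfl⟩ := List.getElem_of_mem hy
    rw [List.length_take] at ht'
    rw [List.getElem_take]
    by_contra hlt
    have := hadm t (by omega) (by omega)
    have := gapCount_mono (g := g) I (not_lt.mp hlt)
    omega
  have h1 : (N.take (gapCount g I x)).countP (x < ·) = 0 := by
    rw [List.countP_eq_zero]
    intro y hy
    have := htake y hy
    simp
    omega
  have h2 : gapCount g I x + (N.drop (gapCount g I x)).countP (· < x) = N.countP (· < x) := by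
    conv_rhs => rw [← List.take_append_drop (gapCount g I x) N, List.countP_append]
    congr 1
    rw [List.countP_eq_length.mpr, List.length_take]
    · omega
    · intro y hy
      simpa using htake y hy
  have h3 : N.countP (· < x) + (J.filter (· < x)).card = x - 1 := by
    have hNf : N.toFinset = Icc 1 n \ J := by
      ext y
      rw [List.mem_toFinset, mem_restWord hIs σ]
    rw [countP_eq_card (nodup_restWord I σ), hNf, ← card_union_of_disjoint
      (disjoint_filter_filter sdiff_disjoint), ← filter_union, sdiff_union_of_subset hJs]
    have : (Icc 1 n).filter (· < x) = Icc 1 (x - 1) := by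
      ext y
      rw [mem_filter, mem_Icc, mem_Icc]
      omega
    rw [this, Nat.card_Icc]
    omega
  have h4 : gapCount g I x + (I.filter (· + g ≤ x)).card = x - g := by
    have hsub : I.filter (· + g ≤ x) ⊆ Icc 1 (x - g) := by
      intro p hp
      rw [mem_filter] at hp
      have := mem_Icc.mp (hIs hp.1)
      rw [mem_Icc]
      omega
    have : Icc 1 (x - g) \ I = Icc 1 (x - g) \ I.filter (· + g ≤ x) := by
      ext p
      rw [mem_sdiff, mem_sdiff, mem_filter, mem_Icc]
      refine and_congr_right fun hp => ?_
      have : p + g ≤ x := by omega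
      simp [this]
    rw [gapCount, this, card_sdiff_add_card_eq_card hsub, Nat.card_Icc]
    rfl
  have h5 := card_filter_add_card_filter_not (s := I) (fun p => p + g ≤ x)
  have h6 : (J.filter (· < x)).card + 1 + (J.filter (x < ·)).card = J.card := by
    rw [← card_filter_add_card_filter_not (s := J) (· < x), add_assoc, add_left_cancel_iff,
      add_comm, ← card_insert_of_notMem (a := x) (by simp)]
    congr 1
    ext y
    rw [mem_insert, mem_filter, mem_filter]
    constructor
    · rintro (rfl | ⟨h1, h2⟩)
      · exact ⟨hx, lt_irrefl _⟩
      · exact ⟨h1, h2.not_gt⟩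
    · rintro ⟨h1, h2⟩
      rcases (not_lt.mp h2).eq_or_lt with h | h
      · exact Or.inl h.symm
      · exact Or.inr ⟨h1, h⟩
  -- The new inversions in N are the letters below x outside the prefix: (x - 1 - #{J < x}) minus (x
  -- - g - #{low places}). Adding the high places from `invOn_bumpWord` gives g - 1 + |J| - #{J <
  -- x}, which is g + #{J > x}.
  rw [h1]
  omega

end Insertion

/-! ### Joint bijectivity of the insertions -/

/-- The ways to insert the new greatest letter into `σ`: into the word of the letters that are no
excedances, in exchange for an excedance letter, or at a new excedance place. -/
def excSlots (g m : ℕ) {n : ℕ} (σ : Equiv.Perm (Fin n)) : Finset (ℕ ⊕ ℕ ⊕ ℕ) :=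
  (range g).disjSum (((excSet g m n (word σ)).image (word σ)).disjSum
    (Icc 1 (n + 1 - g) \ excSet g m n (word σ)))

/-- `π` arises from `σ` by the insertion of the new greatest letter in the way `s`. -/
def IsInsertion (g m : ℕ) {n : ℕ} (σ : Equiv.Perm (Fin n)) (π : Equiv.Perm (Fin (n + 1))) :
    ℕ ⊕ ℕ ⊕ ℕ → Prop
  | .inl c => HasParts g m (excSet g m n (word σ)) (word σ)
      ((restWord (excSet g m n (word σ)) n (word σ)).insertIdx
        ((restWord (excSet g m n (word σ)) n (word σ)).length - c) (n + 1)) π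
  | .inr (.inl x) => HasParts g m (excSet g m n (word σ))
      (bumpWord g (excSet g m n (word σ)) (word σ) (n + 1) x)
      ((restWord (excSet g m n (word σ)) n (word σ)).insertIdx
        (gapCount g (excSet g m n (word σ)) x) x) π
  | .inr (.inr i) => HasParts g m (insert i (excSet g m n (word σ)))
      (Function.update (word σ) i (n + 1)) (restWord (excSet g m n (word σ)) n (word σ)) π

section Insertion

variable {g m n : ℕ}

theorem inl_mem_excSlots {σ : Equiv.Perm (Fin n)} {c : ℕ} :
    Sum.inl c ∈ excSlots g m σ ↔ c < g := by
  rw [excSlots, inl_mem_disjSum, mem_range]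

theorem inr_inl_mem_excSlots {σ : Equiv.Perm (Fin n)} {x : ℕ} :
    Sum.inr (Sum.inl x) ∈ excSlots g m σ ↔ x ∈ (excSet g m n (word σ)).image (word σ) := by
  rw [excSlots, inr_mem_disjSum, inl_mem_disjSum]

theorem inr_inr_mem_excSlots {σ : Equiv.Perm (Fin n)} {i : ℕ} :
    Sum.inr (Sum.inr i) ∈ excSlots g m σ ↔ i ∈ Icc 1 (n + 1 - g) \ excSet g m n (word σ) := by
  rw [excSlots, inr_mem_disjSum, inr_mem_disjSum]

theorem exists_isInsertion (hm : m ≤ n + 1) (hgn : g ≤ n) (σ : Equiv.Perm (Fin n))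
    {s : ℕ ⊕ ℕ ⊕ ℕ} (hs : s ∈ excSlots g m σ) : ∃ π, IsInsertion g m σ π s := by
  rcases s with c | x | i
  · exact exists_hasParts_rest σ hgn (inl_mem_excSlots.mp hs)
  · exact exists_hasParts_bump σ (inr_inl_mem_excSlots.mp hs)
  · exact exists_hasParts_new σ hm hgn (inr_inr_mem_excSlots.mp hs)

theorem card_image_word_excSet (σ : Equiv.Perm (Fin n)) :
    ((excSet g m n (word σ)).image (word σ)).card = (excSet g m n (word σ)).card :=
  card_image_of_injOn fun _ hp _ hq h =>
    word_inj σ (excSet_subset _ _ _ _ hp) (excSet_subset _ _ _ _ hq) h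

/-- All excedance places lie in [n - g], so the three kinds of slots number g, |I| and n + 1 - g -
|I|. -/
theorem card_excSet_add_card_sdiff (hgn : g ≤ n) (σ : Equiv.Perm (Fin n)) :
    g + (excSet g m n (word σ)).card + (Icc 1 (n + 1 - g) \ excSet g m n (word σ)).card
      = n + 1 := by
  have h := card_sdiff_add_card_eq_card
    ((excSet_subset_Icc_sub (g := g) (m := m) σ).trans (Icc_subset_Icc_right
      (show n - g ≤ n + 1 - g by omega)))
  rw [Nat.card_Icc] at h
  omega

theorem card_excSlots (hgn : g ≤ n) (σ : Equiv.Perm (Fin n)) :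
    (excSlots g m σ).card = n + 1 := by
  rw [excSlots, card_disjSum, card_disjSum, card_range, card_image_word_excSet, ← add_assoc,
    card_excSet_add_card_sdiff hgn]

theorem succ_notMem_restWord (σ : Equiv.Perm (Fin n)) :
    n + 1 ∉ restWord (excSet g m n (word σ)) n (word σ) := fun h => by
  have := (mem_sdiff.mp ((mem_restWord (excSet_subset _ _ _ _) σ).mp h)).1
  rw [mem_Icc] at this
  omega

theorem insertIdx_succ_inj {N N' : List ℕ} {M t t' : ℕ} (hM : M ∉ N) (hM' : M ∉ N')
    (ht : t ≤ N.length) (ht' : t' ≤ N'.length) (h : N.insertIdx t M = N'.insertIdx t' M) :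
    t = t' ∧ N = N' := by
  have aux : ∀ {N : List ℕ} {t : ℕ}, M ∉ N → t ≤ N.length → (N.insertIdx t M).erase M = N ∧
      (N.insertIdx t M).idxOf M = t := by
    intro N
    induction N with
    | nil =>
      intro t _ ht
      obtain rfl : t = 0 := by simpa using ht
      simp
    | cons a N ih =>
      intro t hM ht
      rw [List.mem_cons, not_or] at hM
      cases t with
      | zero => simp
      | succ t =>
        obtain ⟨h1, h2⟩ := ih hM.2 (t := t) (by simpa using ht)
        rw [List.insertIdx_succ_cons, List.erase_cons_tail (by simpa using Ne.symm hM.1), h1,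
          List.idxOf_cons_ne _ (Ne.symm hM.1), h2]
        exact ⟨rfl, rfl⟩
  obtain ⟨h1, h2⟩ := aux hM ht
  obtain ⟨h3, h4⟩ := aux hM' ht'
  rw [h] at h1 h2
  exact ⟨h2.symm.trans h4, h1.symm.trans h3⟩

theorem place_le_of_bumpWord_eq {σ : Equiv.Perm (Fin n)} {x p : ℕ}
    (hp : p ∈ excSet g m n (word σ))
    (h : bumpWord g (excSet g m n (word σ)) (word σ) (n + 1) x p = n + 1) : p + g ≤ x := by
  by_contra hn
  rw [bumpWord, if_neg hn] at h
  have := mem_Icc.mp (word_mem σ (excSet_subset _ _ _ _ hp))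
  omega

theorem length_and_gapCount {σ : Equiv.Perm (Fin n)} {x : ℕ}
    (hx : x ∈ (excSet g m n (word σ)).image (word σ)) :
    m ≤ x ∧ x ≤ n ∧ gapCount g (excSet g m n (word σ)) x
      ≤ (restWord (excSet g m n (word σ)) n (word σ)).length := by
  obtain ⟨p, hp, rfl⟩ := mem_image.mp hx
  have h := mem_excSet.mp hp
  have := mem_Icc.mp (word_mem σ h.1)
  exact ⟨h.2.2, this.2, gapCount_le_length σ _ this.2⟩

/-- In an exchange x is tight for the excedance set of π. If instead i were the new place, which
carries n + 1 and hence satisfies i + g ≤ x, removing i from that set would raise the gap count of x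
by one and break admissibility for σ'. -/
theorem not_isInsertion_bump_and_new {σ σ' : Equiv.Perm (Fin n)} {π : Equiv.Perm (Fin (n + 1))}
    {x i : ℕ} (hx : x ∈ (excSet g m n (word σ)).image (word σ))
    (hi : i ∈ Icc 1 (n + 1 - g) \ excSet g m n (word σ'))
    (h : IsInsertion g m σ π (.inr (.inl x))) : ¬ IsInsertion g m σ' π (.inr (.inr i)) := by
  intro h'
  obtain ⟨h1, h2, h3⟩ := h
  obtain ⟨h1', h2', h3'⟩ := h'
  rw [mem_sdiff, mem_Icc] at hi
  obtain ⟨hmx, hxn, hl⟩ := length_and_gapCount hx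
  have hI := h1.symm.trans h1'
  have hii : i ∈ excSet g m n (word σ) := hI ▸ mem_insert_self _ _
  have hix : i + g ≤ x := by
    refine place_le_of_bumpWord_eq hii ?_
    rw [← h2 i hii, h2' i (mem_insert_self _ _), Function.update_self]
  have hN : restWord (excSet g m n (word σ')) n (word σ') =
      (restWord (excSet g m n (word σ)) n (word σ)).insertIdx
        (gapCount g (excSet g m n (word σ)) x) x := by
    rw [← h3, ← h3', hI]
  have hadm : Admissible g m (excSet g m n (word σ')) _ :=
    admissible_restWord fun p hp => word_mem σ' hp
  rw [hN] at hadm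
  have := hadm (gapCount g (excSet g m n (word σ)) x)
    (by rw [List.length_insertIdx_of_le_length hl]; omega)
  rw [List.getElem_insertIdx_self] at this
  have := this hmx
  rw [gapCount_insert hi.2 hi.1.1 hix, ← hI] at this
  omega

/-- The first kind of insertion is recognised in π by n + 1 being no excedance letter. -/
theorem isInsertion_inl_iff {σ : Equiv.Perm (Fin n)} {π : Equiv.Perm (Fin (n + 1))}
    {s : ℕ ⊕ ℕ ⊕ ℕ} (hs : s ∈ excSlots g m σ) (h : IsInsertion g m σ π s) :
    s.isLeft ↔ n + 1 ∈ restWord (excSet g m (n + 1) (word π)) (n + 1) (word π) := by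
  rcases s with c | x | i
  · obtain ⟨h1, -, h3⟩ := h
    rw [h1, h3, mem_insertIdx_iff (by omega)]
    simp
  · obtain ⟨h1, -, h3⟩ := h
    obtain ⟨-, hxn, hl⟩ := length_and_gapCount (inr_inl_mem_excSlots.mp hs)
    rw [h1, h3, mem_insertIdx_iff hl]
    have := succ_notMem_restWord (g := g) (m := m) σ
    simp [this]
    omega
  · obtain ⟨h1, -, h3⟩ := h
    rw [h1, h3]
    have := succ_notMem_restWord (g := g) (m := m) σ
    simp [this]

theorem eq_of_parts {σ σ' : Equiv.Perm (Fin n)}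
    (hI : excSet g m n (word σ) = excSet g m n (word σ'))
    (he : ∀ p ∈ excSet g m n (word σ), word σ p = word σ' p)
    (hN : restWord (excSet g m n (word σ)) n (word σ)
      = restWord (excSet g m n (word σ')) n (word σ')) : σ = σ' :=
  HasParts.eq (g := g) (m := m) ⟨rfl, fun _ _ => rfl, rfl⟩ ⟨hI.symm, fun _ _ => rfl, by
    rw [hN, hI]⟩ he

theorem isInsertion_inj {σ σ' : Equiv.Perm (Fin n)} {π : Equiv.Perm (Fin (n + 1))}
    {s s' : ℕ ⊕ ℕ ⊕ ℕ} (hgn : g ≤ n) (hs : s ∈ excSlots g m σ) (hs' : s' ∈ excSlots g m σ')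
    (h : IsInsertion g m σ π s) (h' : IsInsertion g m σ' π s') : σ = σ' ∧ s = s' := by
  have hleft := (isInsertion_inl_iff hs h).trans (isInsertion_inl_iff hs' h').symm
  rcases s with c | x | i <;> rcases s' with c' | x' | i' <;> simp at hleft
  · obtain ⟨h1, h2, h3⟩ := h
    obtain ⟨h1', h2', h3'⟩ := h'
    have hI := h1.symm.trans h1'
    have hM := succ_notMem_restWord (g := g) (m := m) σ
    have hM' := succ_notMem_restWord (g := g) (m := m) σ'
    rw [← hI] at hM' h3'
    obtain ⟨ht, hN⟩ := insertIdx_succ_inj hM hM' (by omega) (by omega) (h3.symm.trans h3')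
    refine ⟨eq_of_parts hI (fun p hp => ?_) (by rw [hN, ← hI]), ?_⟩
    · rw [← h2 p hp, h2' p (hI ▸ hp)]
    · rw [inl_mem_excSlots] at hs hs'
      have h4 := length_restWord (excSet_subset g m n (word σ)) (word σ)
      have h5 := card_excSet_add_card_sdiff (m := m) hgn σ
      -- Since |I| ≤ n - g, the word has at least g > c letters; the subtraction is not truncated
      -- and the position determines c.
      have h6 := card_le_card (excSet_subset_Icc_sub (g := g) (m := m) σ)
      rw [Nat.card_Icc] at h6
      rw [← hN] at ht
      congr 1
      omega
  · have hx := inr_inl_mem_excSlots.mp hs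
    have hx' := inr_inl_mem_excSlots.mp hs'
    obtain ⟨h1, h2, h3⟩ := h
    obtain ⟨h1', h2', h3'⟩ := h'
    have hI := h1.symm.trans h1'
    obtain ⟨hmx, -, hl⟩ := length_and_gapCount hx
    obtain ⟨hmx', -, hl'⟩ := length_and_gapCount hx'
    have hadm : Admissible g m (excSet g m n (word σ)) _ :=
      admissible_restWord fun p hp => word_mem σ hp
    have hadm' : Admissible g m (excSet g m n (word σ')) _ :=
      admissible_restWord fun p hp => word_mem σ' hp
    have hA := image_bump (lt_of_mem_lowLetters (g := g) (m := m) (x := x) σ)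
      (mem_lowLetters_of_mem_image σ hx)
    have hA' := image_bump (lt_of_mem_lowLetters (g := g) (m := m) (x := x') σ')
      (mem_lowLetters_of_mem_image σ' hx')
    have hlt := lt_of_mem_lowLetters (g := g) (m := m) (x := x) σ
    have hlt' := lt_of_mem_lowLetters (g := g) (m := m) (x := x') σ'
    have hxA := mem_lowLetters_of_mem_image σ hx
    have hxA' := mem_lowLetters_of_mem_image σ' hx'
    rw [← hI] at hadm' hl' h3' h2' hlt' hxA' hA'
    have hW := h3.symm.trans h3'
    obtain ⟨rfl, hN⟩ := hadm.gapCount_insertIdx_inj hadm' hmx hmx' hl hl' hW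
    have heq : ∀ p ∈ excSet g m n (word σ),
        bumpWord g (excSet g m n (word σ)) (word σ) (n + 1) x p
          = bumpWord g (excSet g m n (word σ)) (word σ') (n + 1) x p := fun p hp => by
      rw [← h2 p hp, h2' p hp]
    set I := excSet g m n (word σ) with hIdef
    -- The low letters after the exchange are known from π; removing n + 1 and restoring x yields
    -- the low letters before it, and with them the map `bump` to invert.
    have hAA : lowLetters g I (word σ) x = lowLetters g I (word σ') x := by
      have himg : (lowLetters g I (word σ) x).image (bump (lowLetters g I (word σ) x) (n + 1) x)
          = (lowLetters g I (word σ') x).image (bump (lowLetters g I (word σ') x) (n + 1) x) := by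
        conv_lhs => rw [lowLetters, image_image]
        conv_rhs => rw [lowLetters, image_image]
        refine image_congr fun p hp => ?_
        have hp' := mem_filter.mp (mem_coe.mp hp)
        have := heq p hp'.1
        rwa [bumpWord, bumpWord, if_pos hp'.2, if_pos hp'.2] at this
      rw [hA, hA'] at himg
      have := congrArg (fun S => insert x (S.erase (n + 1))) himg
      rwa [erase_insert, erase_insert, insert_erase hxA, insert_erase hxA'] at this
      · exact fun h => lt_irrefl _ (hlt' _ (mem_of_mem_erase h))
      · exact fun h => lt_irrefl _ (hlt _ (mem_of_mem_erase h))
    refine ⟨eq_of_parts hI (fun p hp => ?_) (by rw [← hIdef, hN, ← hI]), rfl⟩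
    have h4 := heq p hp
    by_cases hpx : p + g ≤ x
    · rw [bumpWord, bumpWord, if_pos hpx, if_pos hpx, ← hAA] at h4
      refine bump_inj hlt (mem_image_of_mem _ (mem_filter.mpr ⟨hp, hpx⟩)) ?_ h4
      rw [hAA]
      exact mem_image_of_mem _ (mem_filter.mpr ⟨hp, hpx⟩)
    · rwa [bumpWord, bumpWord, if_neg hpx, if_neg hpx] at h4
  · exact absurd h' (not_isInsertion_bump_and_new (inr_inl_mem_excSlots.mp hs)
      (inr_inr_mem_excSlots.mp hs') h)
  · exact absurd h (not_isInsertion_bump_and_new (inr_inl_mem_excSlots.mp hs')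
      (inr_inr_mem_excSlots.mp hs) h')
  · have hi := mem_sdiff.mp (inr_inr_mem_excSlots.mp hs)
    have hi' := mem_sdiff.mp (inr_inr_mem_excSlots.mp hs')
    rw [mem_Icc] at hi hi'
    obtain ⟨h1, h2, h3⟩ := h
    obtain ⟨h1', h2', h3'⟩ := h'
    have e1 : word π i = n + 1 := by rw [h2 i (mem_insert_self _ _), Function.update_self]
    have e2 : word π i' = n + 1 := by rw [h2' i' (mem_insert_self _ _), Function.update_self]
    obtain rfl : i = i' := word_inj π (mem_Icc.mpr (by omega)) (mem_Icc.mpr (by omega))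
      (e1.trans e2.symm)
    have hII := h1.symm.trans h1'
    have hI : excSet g m n (word σ) = excSet g m n (word σ') := by
      rw [← erase_insert hi.2, hII, erase_insert hi'.2]
    refine ⟨eq_of_parts hI (fun p hp => ?_) ?_, rfl⟩
    · have hpi : p ≠ i := fun h => hi.2 (h ▸ hp)
      have e3 := h2 p (mem_insert_of_mem hp)
      have e4 := h2' p (mem_insert_of_mem (hI ▸ hp))
      rw [Function.update_of_ne hpi] at e3 e4
      rw [← e3, e4]
    · exact h3.symm.trans ((congrArg (restWord · (n + 1) (word π)) hII).trans h3')

/-- The permutation that arises from `σ` by the insertion of the new greatest letter in the way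
`s`. -/
noncomputable def excInsert (g m : ℕ) {n : ℕ} (σ : Equiv.Perm (Fin n)) (s : ℕ ⊕ ℕ ⊕ ℕ) :
    Equiv.Perm (Fin (n + 1)) :=
  open Classical in if h : ∃ π, IsInsertion g m σ π s then h.choose else 1

theorem isInsertion_excInsert (hm : m ≤ n + 1) (hgn : g ≤ n) {σ : Equiv.Perm (Fin n)}
    {s : ℕ ⊕ ℕ ⊕ ℕ} (hs : s ∈ excSlots g m σ) : IsInsertion g m σ (excInsert g m σ s) s := by
  have h := exists_isInsertion hm hgn σ hs
  rw [excInsert, dif_pos h]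
  exact h.choose_spec

end Insertion

/-! ### The recursion for (gexc, gden) -/

theorem card_filter_lt_add_card_filter_le (I : Finset ℕ) (l : ℕ) :
    (I.filter (· < l)).card + (I.filter (l ≤ ·)).card = I.card := by
  rw [← card_filter_add_card_filter_not (s := I) (· < l)]
  congr 2
  exact filter_congr fun p _ => not_lt.symm

/-- After cancellation, the claim compares l - 1 with the number of excedance places below l plus
that of free places below i. For i < l these places together with i fit into [l - 1]; for i ≥ l they
cover [l - 1]. -/
theorem rank_lt_iff {g l n : ℕ} (hl : 1 ≤ l) (σ : Equiv.Perm (Fin n)) {i : ℕ}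
    (hi : i ∈ Icc 1 (n + 1 - g) \ excSet g (g + l) n (word σ)) :
    g + (excSet g (g + l) n (word σ)).card
      + ((Icc 1 (n + 1 - g) \ excSet g (g + l) n (word σ)).filter (· < i)).card
        < ((excSet g (g + l) n (word σ)).filter (l ≤ ·)).card + (g + l - 1) ↔ i < l := by
  have hIs := excSet_subset g (g + l) n (word σ)
  set I := excSet g (g + l) n (word σ)
  set F := Icc 1 (n + 1 - g) \ I with hF
  have h1 := card_filter_lt_add_card_filter_le I l
  have hFI : ∀ {p}, p ∈ F ↔ (1 ≤ p ∧ p ≤ n + 1 - g) ∧ p ∉ I := by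
    intro p
    rw [hF, mem_sdiff, mem_Icc]
  have hi' := hFI.mp hi
  have hdisj : Disjoint (I.filter (· < l)) (F.filter (· < i)) :=
    disjoint_filter_filter disjoint_sdiff
  have h2 := card_union_of_disjoint hdisj
  by_cases hil : i < l
  · have hsub : insert i (I.filter (· < l) ∪ F.filter (· < i)) ⊆ Icc 1 (l - 1) := by
      intro p hp
      rw [mem_insert, mem_union, mem_filter, mem_filter, hFI] at hp
      rw [mem_Icc]
      rcases hp with rfl | hp | hp
      · omega
      · have := mem_Icc.mp (hIs hp.1)
        omega
      · omega
    have h3 := card_le_card hsub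
    have hni : i ∉ I.filter (· < l) ∪ F.filter (· < i) := by
      rw [mem_union, mem_filter, mem_filter]
      rintro (h | h)
      · exact hi'.2 h.1
      · exact lt_irrefl _ h.2
    rw [card_insert_of_notMem hni, h2, Nat.card_Icc] at h3
    omega
  · have hsub : Icc 1 (l - 1) ⊆ I.filter (· < l) ∪ F.filter (· < i) := by
      intro p hp
      rw [mem_Icc] at hp
      rw [mem_union, mem_filter, mem_filter, hFI]
      by_cases hpI : p ∈ I
      · exact Or.inl ⟨hpI, by omega⟩
      · exact Or.inr ⟨⟨by omega, hpI⟩, by omega⟩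
    have h3 := card_le_card hsub
    rw [h2, Nat.card_Icc] at h3
    omega

theorem sum_gexc_gden_succ {M : Type*} [AddCommMonoid M] {g l : ℕ} (hg : 1 ≤ g) (hl : 1 ≤ l)
    {n : ℕ} (hn : g + l - 1 ≤ n) (f : ℕ → ℕ → M) :
    ∑ π : Equiv.Perm (Fin (n + 1)), f (gexc g l π) (gden g (g + l) π) =
      ∑ σ : Equiv.Perm (Fin n), ∑ c ∈ range (n + 1),
        f (if c < gexc g l σ + (g + l - 1) then gexc g l σ else gexc g l σ + 1)
          (gden g (g + l) σ + c) := by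
  have hm : g + l ≤ n + 1 := by omega
  have hgn : g ≤ n := by omega
  have hins := fun σ s => isInsertion_excInsert (σ := σ) (s := s) hm hgn
  rw [sum_perm_succ (excSlots g (g + l)) (card_excSlots hgn) (excInsert g (g + l))
    fun σ s hs σ' s' hs' h => isInsertion_inj hgn hs hs' (hins σ s hs) (h ▸ hins σ' s' hs')]
  refine sum_congr rfl fun σ _ => ?_
  have hcard := card_excSet_add_card_sdiff (m := g + l) hgn σ
  have hk := gexc_eq g l σ
  have hsplit := card_filter_lt_add_card_filter_le (excSet g (g + l) n (word σ)) l
  -- At most l - 1 excedance places lie below l, so g + |I| ≤ k + (g + l - 1): every label of the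
  -- first two kinds is under the threshold.
  have hlow : ((excSet g (g + l) n (word σ)).filter (· < l)).card ≤ l - 1 := by
    have : (excSet g (g + l) n (word σ)).filter (· < l) ⊆ Icc 1 (l - 1) := by
      intro p hp
      rw [mem_filter] at hp
      have := mem_Icc.mp (excSet_subset _ _ _ _ hp.1)
      rw [mem_Icc]
      omega
    simpa using card_le_card this
  have hJ := card_image_word_excSet (g := g) (m := g + l) σ
  set k := gexc g l σ
  set d := gden g (g + l) σ with hd
  set H : ℕ → M := fun c => f (if c < k + (g + l - 1) then k else k + 1) (d + c) with hH
  rw [excSlots, sum_disjSum, sum_disjSum]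
  have hA : ∑ c ∈ range g, f (gexc g l (excInsert g (g + l) σ (.inl c)))
      (gden g (g + l) (excInsert g (g + l) σ (.inl c))) = ∑ c ∈ range g, H c := by
    refine sum_congr rfl fun c hc => ?_
    rw [mem_range] at hc
    have h := hins σ (.inl c) (inl_mem_excSlots.mpr hc)
    rw [gden_of_hasParts_rest σ hg hgn hc h, HasParts.gexc_eq h, ← hk, hH]
    dsimp only
    rw [if_pos (by omega)]
  have hB : ∑ x ∈ (excSet g (g + l) n (word σ)).image (word σ),
      f (gexc g l (excInsert g (g + l) σ (.inr (.inl x))))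
        (gden g (g + l) (excInsert g (g + l) σ (.inr (.inl x))))
      = ∑ c ∈ range (excSet g (g + l) n (word σ)).card, H (g + c) := by
    rw [← hJ, ← sum_rank_gt _ fun c => H (g + c)]
    refine sum_congr rfl fun x hx => ?_
    have h := hins σ (.inr (.inl x)) (inr_inl_mem_excSlots.mpr hx)
    rw [gden_of_hasParts_bump σ hg hx h, HasParts.gexc_eq h, ← hk, hH]
    dsimp only
    have : (((excSet g (g + l) n (word σ)).image (word σ)).filter (x < ·)).card
        < ((excSet g (g + l) n (word σ)).image (word σ)).card :=
      card_lt_card (filter_ssubset.mpr ⟨x, hx, lt_irrefl x⟩)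
    rw [if_pos (by omega)]
  have hC : ∑ i ∈ Icc 1 (n + 1 - g) \ excSet g (g + l) n (word σ),
      f (gexc g l (excInsert g (g + l) σ (.inr (.inr i))))
        (gden g (g + l) (excInsert g (g + l) σ (.inr (.inr i))))
      = ∑ c ∈ range (Icc 1 (n + 1 - g) \ excSet g (g + l) n (word σ)).card,
        H (g + (excSet g (g + l) n (word σ)).card + c) := by
    rw [← sum_rank_lt _ fun c => H (g + (excSet g (g + l) n (word σ)).card + c)]
    refine sum_congr rfl fun i hi => ?_
    have h := hins σ (.inr (.inr i)) (inr_inr_mem_excSlots.mpr hi)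
    rw [gden_of_hasParts_new σ hg hi h, HasParts.gexc_eq h, hH]
    dsimp only
    congr 1
    have hr := rank_lt_iff hl σ hi
    rw [← hk] at hr
    rw [filter_insert]
    by_cases hil : i < l
    · rw [if_pos (hr.mpr hil), if_neg (by omega), hk]
    · rw [if_neg (fun h => hil (hr.mp h)), if_pos (by omega), card_insert_of_notMem, hk]
      exact fun h => (mem_sdiff.mp hi).2 (mem_filter.mp h).1
  rw [hA, hB, hC, ← add_assoc, ← sum_range_add, ← sum_range_add, hcard]

/-! ### The initial range and the conclusion -/

theorem excSet_eq_empty {g m n : ℕ} (hn : n < m) (π : Equiv.Perm (Fin n)) :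
    excSet g m n (word π) = ∅ := by
  rw [eq_empty_iff_forall_notMem]
  intro p hp
  rw [mem_excSet] at hp
  have := mem_Icc.mp (word_mem π hp.1)
  omega

theorem gexc_eq_zero {g l n : ℕ} (hn : n < g + l) (π : Equiv.Perm (Fin n)) : gexc g l π = 0 := by
  rw [gexc_eq, excSet_eq_empty hn, filter_empty, card_empty]

theorem gden_eq_inv {g m n : ℕ} (hg : 1 ≤ g) (hn : n < m) (π : Equiv.Perm (Fin n)) :
    gden g m π = invOn (Icc 1 n) (word π) := by
  rw [gden_eq hg, excSet_eq_empty hn, listInv_restWord, sdiff_empty]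
  simp [invOn]

/-- The test function `f` is arbitrary so that the induction closes: the sum over the labels c is
itself a function of the two statistics of σ. -/
theorem sum_gexc_gden_eq_sum_rdes_rmaj {M : Type*} [AddCommMonoid M] {g l : ℕ} (hg : 1 ≤ g)
    (hl : 1 ≤ l) (n : ℕ) (f : ℕ → ℕ → M) :
    ∑ π : Equiv.Perm (Fin n), f (gexc g l π) (gden g (g + l) π) =
      ∑ π : Equiv.Perm (Fin n), f (rdes (g + l - 1) π) (rmaj (g + l - 1) π) := by
  rcases le_or_gt n (g + l - 1) with hn | hn
  · refine sum_congr rfl fun π _ => ?_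
    rw [gexc_eq_zero (by omega), gden_eq_inv hg (by omega), rdes_eq_zero hn, rmaj_eq_inv hn]
  · obtain ⟨n, rfl⟩ : ∃ k, n = k + 1 := ⟨n - 1, by omega⟩
    rw [sum_gexc_gden_succ hg hl (by omega), sum_rdes_rmaj_succ _ (by omega) (by omega)]
    exact sum_gexc_gden_eq_sum_rdes_rmaj hg hl n fun a b => ∑ c ∈ range (n + 1),
      f (if c < a + (g + l - 1) then a else a + 1) (b + c)

end PermStat

theorem mainTheorem2 (g l : ℕ) (hg : 1 ≤ g) (hl : 1 ≤ l) (n : ℕ) :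
    PermStat.IsEulerMahonian (g + l - 1) n
      (fun π => PermStat.gexc g l π) (fun π => PermStat.gden g (g + l) π) :=
  PermStat.sum_gexc_gden_eq_sum_rdes_rmaj hg hl n fun a b =>
    MvPolynomial.X 0 ^ a * MvPolynomial.X 1 ^ b
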